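/- Let $J_\nu$ and $Y_\nu$ be the Bessel functions of the first and second kind and $K_\nu$ the modified Bessel function of the second kind, let primes denote derivatives with respect to the argument, and put $b_0(\nu)=1$, \[ b_n(\nu)=\frac{\big((4\nu^2-1^2)(4\nu^2-3^2)\cdots(4\nu^2-(2n-3)^2)\big)(4\nu^2+4n^2-1)}{8^n\,n!}\qquad(n\ge 1), \] where the empty product (for $n=1$) is $1$. For real $\nu$, $z>0$ and $\omega=z-\frac{\pi}{2}\nu-\frac{\pi}{4}$, define the remainders $R_N^{(K')}(z,\nu)$ and $R_N^{(J')}(z,\nu)$ ($N\ge 0$) of the large-argument expansions of $K'_\nu$ and $J'_\nu$ by \[ K'_\nu(z)=-\Big(\frac{\pi}{2z}\Big)^{1/2}e^{-z}\Big(\sum_{n=0}^{N-1}\frac{b_n(\nu)}{z^n}+R_N^{(K')}(z,\nu)\Big) \] and, for all integers $n,m\ge 0$, \[ J'_\nu(z)=-\Big(\frac{2}{\pi z}\Big)^{1/2}\big(\sin\omega\; S_n+\cos\omega\; T_m\big),\qquad Y'_\nu(z)=\Big(\frac{2}{\pi z}\Big)^{1/2}\big(\cos\omega\; S_n-\sin\omega\;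 T_m\big), \] where \[ S_n=\sum_{k=0}^{n-1}(-1)^k\frac{b_{2k}(\nu)}{z^{2k}}+R_{2n}^{(J')}(z,\nu),\qquad T_m=\sum_{k=0}^{m-1}(-1)^k\frac{b_{2k+1}(\nu)}{z^{2k+1}}-R_{2m+1}^{(J')}(z,\nu); \] the last two identities together determine $R_{2n}^{(J')}$ and $R_{2m+1}^{(J')}$ uniquely. Theorem. Let $N$ be a positive integer, $z$ a positive real number and $\nu$ a real number with $|\nu|<N-\frac12$. Then \[ R_N^{(K')}(z,\nu)=\frac{b_N(\nu)}{z^N}\,\theta_N^{(K')}(z,\nu) \quad\text{and}\quad R_N^{(J')}(z,\nu)=(-1)^{\lceil N/2\rceil}\,\frac{b_N(\nu)}{z^N}\,\theta_N^{(J')}(z,\nu), \] where $0<\theta_N^{(K')}(z,\nu)<1$ and $0<\theta_N^{(J')}(z,\nu)<1$ are suitable numbers that depend on $z$, $\nu$ and $N$. -/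

import Mathlib

open Filter Topology

/-- The modified Bessel function `K_ν(x)` (Macdonald function) of real order `ν`, for `x > 0`. -/
noncomputable def besselK (ν x : ℝ) : ℝ :=
  ∫ t in Set.Ioi (0 : ℝ), Real.exp (-(x * Real.cosh t)) * Real.cosh (ν * t)

/-- The Bessel function of the first kind `J_ν(x)` of real order `ν`, for `x > 0`, by its power
series. Since `Real.Gamma` takes the value `0` at the poles of the Gamma function, the terms in
which `1 / Γ(ν + k + 1)` has to be read as `0` do vanish. -/
noncomputable def besselJ (ν x : ℝ) : ℝ :=
  ∑' k : ℕ, (-1) ^ k / (Nat.factorial k * Real.Gamma (ν + k + 1)) * (x / 2) ^ (ν + 2 * k)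

/-- The Bessel function of the second kind `Y_ν(x)` of real order `ν`, for `x > 0`: Weber's
quotient, and its limit in the order if `ν` is an integer. -/
noncomputable def besselY (ν x : ℝ) : ℝ :=
  limUnder (𝓝[≠] ν) fun μ : ℝ =>
    (besselJ μ x * Real.cos (Real.pi * μ) - besselJ (-μ) x) / Real.sin (Real.pi * μ)

/-- The derivative `K'_ν(x)` with respect to the argument. -/
noncomputable def besselKDeriv (ν x : ℝ) : ℝ := deriv (fun y : ℝ => besselK ν y) x

/-- The derivative `J'_ν(x)` with respect to the argument. -/
noncomputable def besselJDeriv (ν x : ℝ) : ℝ := deriv (fun y : ℝ => besselJ ν y) x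

/-- The derivative `Y'_ν(x)` with respect to the argument. -/
noncomputable def besselYDeriv (ν x : ℝ) : ℝ := deriv (fun y : ℝ => besselY ν y) x

/-- The coefficients `b_n(ν)`: `b_0(ν) = 1`, and for `n ≥ 1`
`b_n(ν) = (4ν² - 1²)(4ν² - 3²) ⋯ (4ν² - (2n - 3)²) (4ν² + 4n² - 1) / (8ⁿ n!)`. -/
noncomputable def coeffB (ν : ℝ) : ℕ → ℝ
  | 0 => 1
  | n + 1 =>
      ((∏ k ∈ Finset.range n, (4 * ν ^ 2 - (2 * (k : ℝ) + 1) ^ 2)) *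
          (4 * ν ^ 2 + 4 * ((n : ℝ) + 1) ^ 2 - 1)) /
        (8 ^ (n + 1) * Nat.factorial (n + 1))

/-- The phase `ω = z - πν/2 - π/4`. -/
noncomputable def besselPhase (z ν : ℝ) : ℝ := z - Real.pi / 2 * ν - Real.pi / 4

/-- The remainder `R_N^{(K')}(z, ν)` of the large-argument expansion of `K'_ν(z)`. -/
noncomputable def remKDeriv (N : ℕ) (z ν : ℝ) : ℝ :=
  -besselKDeriv ν z / (Real.sqrt (Real.pi / (2 * z)) * Real.exp (-z)) -
    ∑ n ∈ Finset.range N, coeffB ν n / z ^ n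

/-- The partial sum of the first `n` terms of the even-index series. -/
noncomputable def evenSum (n : ℕ) (z ν : ℝ) : ℝ :=
  ∑ k ∈ Finset.range n, (-1) ^ k * (coeffB ν (2 * k) / z ^ (2 * k))

/-- The partial sum of the first `m` terms of the odd-index series. -/
noncomputable def oddSum (m : ℕ) (z ν : ℝ) : ℝ :=
  ∑ k ∈ Finset.range m, (-1) ^ k * (coeffB ν (2 * k + 1) / z ^ (2 * k + 1))

/-- The remainders `R_N^{(J')}(z, ν)`, `N = 2n` or `N = 2m + 1`, common to the large-argument
expansions of `J'_ν(z)` and `Y'_ν(z)`. They are the only numbers for which the two identities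
`besselJDeriv_eq` and `besselYDeriv_eq` hold (see `remJDeriv_unique`). -/
noncomputable def remJDeriv (N : ℕ) (z ν : ℝ) : ℝ :=
  if Even N then
    (-Real.sin (besselPhase z ν) * besselJDeriv ν z +
        Real.cos (besselPhase z ν) * besselYDeriv ν z) / Real.sqrt (2 / (Real.pi * z)) -
      evenSum (N / 2) z ν
  else
    oddSum (N / 2) z ν +
      (Real.cos (besselPhase z ν) * besselJDeriv ν z +
        Real.sin (besselPhase z ν) * besselYDeriv ν z) / Real.sqrt (2 / (Real.pi * z))

/-- The defining identity of `R_N^{(K')}`. -/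
theorem besselKDeriv_eq (N : ℕ) {z : ℝ} (hz : 0 < z) (ν : ℝ) :
    besselKDeriv ν z = -(Real.sqrt (Real.pi / (2 * z)) * Real.exp (-z)) *
      (∑ n ∈ Finset.range N, coeffB ν n / z ^ n + remKDeriv N z ν) := by
  have h : Real.sqrt (Real.pi / (2 * z)) * Real.exp (-z) ≠ 0 := by positivity
  unfold remKDeriv
  generalize Real.sqrt (Real.pi / (2 * z)) * Real.exp (-z) = c at h ⊢
  field_simp
  ring

theorem remJDeriv_even (n : ℕ) (z ν : ℝ) :
    remJDeriv (2 * n) z ν =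
      (-Real.sin (besselPhase z ν) * besselJDeriv ν z +
        Real.cos (besselPhase z ν) * besselYDeriv ν z) / Real.sqrt (2 / (Real.pi * z)) -
      evenSum n z ν := by
  simp [remJDeriv]

theorem remJDeriv_odd (m : ℕ) (z ν : ℝ) :
    remJDeriv (2 * m + 1) z ν =
      oddSum m z ν +
      (Real.cos (besselPhase z ν) * besselJDeriv ν z +
        Real.sin (besselPhase z ν) * besselYDeriv ν z) / Real.sqrt (2 / (Real.pi * z)) := by
  have h : (2 * m + 1) / 2 = m := by omega
  simp [remJDeriv, h]

/-- The identity for `J'_ν` in which the remainders `R_{2N}^{(J')}` and `R_{2M+1}^{(J')}`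
appear. -/
theorem besselJDeriv_eq (N M : ℕ) {z : ℝ} (hz : 0 < z) (ν : ℝ) :
    besselJDeriv ν z = -Real.sqrt (2 / (Real.pi * z)) *
      (Real.sin (besselPhase z ν) * (evenSum N z ν + remJDeriv (2 * N) z ν) +
        Real.cos (besselPhase z ν) * (oddSum M z ν - remJDeriv (2 * M + 1) z ν)) := by
  have h : Real.sqrt (2 / (Real.pi * z)) ≠ 0 := by positivity
  rw [remJDeriv_even, remJDeriv_odd]
  generalize Real.sqrt (2 / (Real.pi * z)) = c at h ⊢
  field_simp
  linear_combination (-besselJDeriv ν z) * Real.sin_sq_add_cos_sq (besselPhase z ν)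

/-- The identity for `Y'_ν` in which the remainders `R_{2N}^{(J')}` and `R_{2M+1}^{(J')}`
appear. -/
theorem besselYDeriv_eq (N M : ℕ) {z : ℝ} (hz : 0 < z) (ν : ℝ) :
    besselYDeriv ν z = Real.sqrt (2 / (Real.pi * z)) *
      (Real.cos (besselPhase z ν) * (evenSum N z ν + remJDeriv (2 * N) z ν) -
        Real.sin (besselPhase z ν) * (oddSum M z ν - remJDeriv (2 * M + 1) z ν)) := by
  have h : Real.sqrt (2 / (Real.pi * z)) ≠ 0 := by positivity
  rw [remJDeriv_even, remJDeriv_odd]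
  generalize Real.sqrt (2 / (Real.pi * z)) = c at h ⊢
  field_simp
  linear_combination (-besselYDeriv ν z) * Real.sin_sq_add_cos_sq (besselPhase z ν)

/-- The identities for `J'_ν` and `Y'_ν` determine the remainders. -/
theorem remJDeriv_unique (N M : ℕ) {z : ℝ} (hz : 0 < z) (ν r s : ℝ)
    (hJ : besselJDeriv ν z = -Real.sqrt (2 / (Real.pi * z)) *
      (Real.sin (besselPhase z ν) * (evenSum N z ν + r) +
        Real.cos (besselPhase z ν) * (oddSum M z ν - s)))
    (hY : besselYDeriv ν z = Real.sqrt (2 / (Real.pi * z)) *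
      (Real.cos (besselPhase z ν) * (evenSum N z ν + r) -
        Real.sin (besselPhase z ν) * (oddSum M z ν - s))) :
    r = remJDeriv (2 * N) z ν ∧ s = remJDeriv (2 * M + 1) z ν := by
  have h : Real.sqrt (2 / (Real.pi * z)) ≠ 0 := by positivity
  rw [remJDeriv_even, remJDeriv_odd, hJ, hY]
  generalize Real.sqrt (2 / (Real.pi * z)) = c at h ⊢
  constructor
  · field_simp
    linear_combination (-(evenSum N z ν + r)) * Real.sin_sq_add_cos_sq (besselPhase z ν)
  · field_simp
    linear_combination (oddSum M z ν - s) * Real.sin_sq_add_cos_sq (besselPhase z ν)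

/-!
Put `a = |ν| - 1/2` and `M_ν(ζ) = ∫₀^∞ e^(-u) u^a (1 + u ζ)^a du / Γ(|ν| + 1/2)`. Up to elementary
factors, `K_ν(x)` is `M_ν(1 / (2 x))` and the Hankel function `J_ν(x) + i Y_ν(x)` is
`M_ν(i / (2 x))`, so that both expansions are the cases `ε = 1` and `ε = i` of one expansion, that
of `M_ν(ε h)` in powers of `h > 0`.

*The remainder.* In Taylor's formula for `(1 + ε y)^a` (`one_add_cpow_taylor`) the remainder after
`N` terms is the first omitted coefficient times `ε^N q_N(y)`, where `q_N` is an iterated primitive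
of `q₀(y) = (1 + ε y)^(a - N)`. For `N > a` the modulus of `q₀` is less than `1`, hence
`|q_N(y)| < y^N` (`norm_taylorKernel_lt`). Also `Re q_N(y) > 0`: this is clear for `ε = 1`, and for
`ε = i` it has to be shown for one of `q₀`, `q₁`, `q₂` only, since integration preserves it
(`re_taylorKernel_I_pos`). Integrated against `e^(-u) u^a`, the remainder becomes the first omitted
term times a number with real part in `(0, 1)` (`hankelIntegral_expansion`).

*The derivatives.* From `K_ν' = -(K_(ν-1) + K_(ν+1)) / 2` and `H_ν' = (H_(ν-1) - H_(ν+1)) / 2`,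
where `H = J + i Y`, both derivatives have the slowly varying factor `(M_(ν-1) + M_(ν+1)) / 2`. Its
coefficients are the means of the `a_n(ν-1)` and `a_n(ν+1)`, and these means are the `b_n(ν)`
(`coeffB_eq`). For `|ν| < N - 1/2` the numbers `a_N(ν-1)` and `a_N(ν+1)` do not have opposite signs,
so the two remainders combine to `b_N(ν) / z^N` times a number with real part in `(0, 1)`
(`hankelFactor_mean_expansion`). The powers of `i` then distribute the terms between the real and
the imaginary part.

*The Laplace integral of `K_ν`.* One of the two factors of the integrand is itself written as an
integral, and the order of integration is exchanged (`besselK_eq_hankelIntegral`).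

*The Laplace integral of `J_ν + i Y_ν`.* Hankel's loop integral for `1 / Γ` (`inv_Gamma_one_sub`),
inserted in the power series, gives Schläfli's integrals for `I_ν` and `J_ν` (`hasSum_schlafli`),
hence Macdonald's formula for `K_ν` in terms of `I_ν` and `I_(-ν)`. As an identity between power
series and `M_ν(1 / (2 z))` this extends from the positive half-line to `Re z > 0` by the identity
theorem (`besselSeries_eq_hankelIntegral`), and its boundary value at `z = -i x` is the assertion
for noninteger `ν`. Integers follow by continuity in `ν` (`schlafliHankel_eq`); here `J_ν + i Y_ν` is
represented by Schläfli's integrals, which are continuous in `ν`, and this also evaluates the limit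
in the definition of `Y_ν` (`im_schlafliHankel`).
-/

/-! ### Taylor remainders of `(1 + ε y)^a` -/

/-- The generalized binomial coefficient `a (a - 1) ⋯ (a - n + 1) / n!`. -/
noncomputable def genBinom (a : ℝ) (n : ℕ) : ℝ :=
  (∏ k ∈ Finset.range n, (a - k)) / n.factorial

theorem genBinom_zero (a : ℝ) : genBinom a 0 = 1 := by simp [genBinom]

theorem genBinom_succ (a : ℝ) (n : ℕ) :
    (n + 1) * genBinom a (n + 1) = a * genBinom (a - 1) n := by
  have h : ((n.factorial : ℕ) : ℝ) ≠ 0 := by positivity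
  have h' : (n : ℝ) + 1 ≠ 0 := by positivity
  unfold genBinom
  rw [Finset.prod_range_succ', Nat.factorial_succ]
  have : ∀ k ∈ Finset.range n, a - ((k + 1 : ℕ) : ℝ) = a - 1 - k := by
    intro k _; push_cast; ring
  rw [Finset.prod_congr rfl this]
  push_cast
  field_simp
  ring

/-- The iterated primitives `q₀(y) = (1 + ε y)^(-b)`, `q_{N+1}(y) = (N + 1) ∫₀^y q_N`, which carry
the Taylor remainders of `(1 + ε y)^(N - b)`. Only `y ≥ 0` matters; `|y|` makes `q₀` continuous
on the whole line when `0 ≤ Re ε`. -/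
noncomputable def taylorKernel (ε : ℂ) (b : ℝ) : ℕ → ℝ → ℂ
  | 0, y => (1 + ε * (|y| : ℝ)) ^ (-b : ℂ)
  | N + 1, y => (N + 1) * ∫ v in (0 : ℝ)..y, taylorKernel ε b N v

theorem one_le_re_one_add {ε : ℂ} (hε : 0 ≤ ε.re) {y : ℝ} (hy : 0 ≤ y) :
    1 ≤ (1 + ε * (y : ℂ)).re := by
  simp
  positivity

theorem one_add_mem_slitPlane {ε : ℂ} (hε : 0 ≤ ε.re) {y : ℝ} (hy : 0 ≤ y) :
    1 + ε * (y : ℂ) ∈ Complex.slitPlane :=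
  Or.inl (lt_of_lt_of_le one_pos (one_le_re_one_add hε hy))

theorem one_lt_norm_one_add {ε : ℂ} (hε : 0 ≤ ε.re) (hε1 : ‖ε‖ = 1) {y : ℝ} (hy : 0 < y) :
    1 < ‖1 + ε * (y : ℂ)‖ := by
  have h1 : ε.re ^ 2 + ε.im ^ 2 = 1 := by
    have := Complex.sq_norm ε
    rw [hε1, Complex.normSq_apply] at this
    linarith
  have h2 : ‖1 + ε * (y : ℂ)‖ ^ 2 = (1 + ε.re * y) ^ 2 + (ε.im * y) ^ 2 := by
    rw [Complex.sq_norm, Complex.normSq_apply]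
    simp
    ring
  have h3 : 1 < ‖1 + ε * (y : ℂ)‖ ^ 2 := by
    rw [h2]
    have : (1 + ε.re * y) ^ 2 + (ε.im * y) ^ 2 = 1 + 2 * (ε.re * y) + y ^ 2 := by
      linear_combination y ^ 2 * h1
    rw [this]
    have := mul_nonneg hε hy.le
    have := pow_pos hy 2
    linarith
  nlinarith [norm_nonneg (1 + ε * (y : ℂ))]

theorem continuous_taylorKernel {ε : ℂ} (hε : 0 ≤ ε.re) (b : ℝ) (N : ℕ) :
    Continuous (taylorKernel ε b N) := by
  induction N with
  | zero =>
    have : taylorKernel ε b 0 = fun y => (1 + ε * (|y| : ℝ)) ^ (-b : ℂ) := by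
      ext y; rfl
    rw [this]
    refine Continuous.cpow (by fun_prop) continuous_const fun y =>
      one_add_mem_slitPlane hε (abs_nonneg y)
  | succ N ih =>
    have : taylorKernel ε b (N + 1) =
        fun y => (N + 1) * ∫ v in (0 : ℝ)..y, taylorKernel ε b N v := by
      ext y; rfl
    rw [this]
    exact continuous_const.mul
      (intervalIntegral.continuous_primitive (fun _ _ => ih.intervalIntegrable _ _) 0)

theorem taylorKernel_zero_of_nonneg (ε : ℂ) (b : ℝ) {y : ℝ} (hy : 0 ≤ y) :
    taylorKernel ε b 0 y = (1 + ε * y) ^ (-b : ℂ) := by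
  rw [taylorKernel, abs_of_nonneg hy]

/-- Taylor's formula for `(1 + ε y)^a`, the remainder being expressed by the iterated primitives
with `b = N - a`. This parameter is unchanged when `a` and `N` decrease together, as they do upon
differentiation. -/
theorem one_add_cpow_taylor {ε : ℂ} (hε : 0 ≤ ε.re) (N : ℕ) (a : ℝ) {y : ℝ} (hy : 0 ≤ y) :
    (1 + ε * (y : ℂ)) ^ (a : ℂ) =
      ∑ n ∈ Finset.range N, (genBinom a n : ℂ) * (ε * y) ^ n +
        genBinom a N * ε ^ N * taylorKernel ε (N - a) N y := by
  induction N generalizing a y with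
  | zero => simp [genBinom_zero, taylorKernel_zero_of_nonneg _ _ hy]
  | succ N ih =>
    set f : ℝ → ℂ := fun v => (1 + ε * (v : ℂ)) ^ (a : ℂ) -
      ∑ n ∈ Finset.range (N + 1), (genBinom a n : ℂ) * (ε * v) ^ n with hf
    have hlin : ∀ v : ℝ, HasDerivAt (fun v : ℝ => ε * (v : ℂ)) ε v := fun v => by
      simpa using (Complex.ofRealCLM.hasDerivAt (x := v)).const_mul ε
    have hd : ∀ v : ℝ, 0 ≤ v → HasDerivAt f (ε * a * ((1 + ε * (v : ℂ)) ^ ((a - 1 : ℝ) : ℂ) -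
        ∑ n ∈ Finset.range N, (genBinom (a - 1) n : ℂ) * (ε * v) ^ n)) v := by
      intro v hv
      have h0 : HasDerivAt (fun w : ℂ => w ^ (a : ℂ)) _ (1 + ε * (v : ℂ)) :=
        (hasDerivAt_id (1 + ε * (v : ℂ))).cpow_const (one_add_mem_slitPlane hε hv)
      have h1 : HasDerivAt (fun v : ℝ => (1 + ε * (v : ℂ)) ^ (a : ℂ))
          (a * (1 + ε * (v : ℂ)) ^ ((a : ℂ) - 1) * ε) v :=
        (HasDerivAt.comp (h := fun v : ℝ => 1 + ε * (v : ℂ)) v h0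
          ((hlin v).const_add 1)).congr_deriv (by simp)
      have h2 : HasDerivAt (fun v : ℝ => ∑ n ∈ Finset.range (N + 1),
          (genBinom a n : ℂ) * (ε * v) ^ n)
          (∑ n ∈ Finset.range (N + 1), (genBinom a n : ℂ) * (n * (ε * v) ^ (n - 1) * ε)) v :=
        HasDerivAt.fun_sum fun n _ => ((hlin v).pow n).const_mul _
      refine (h1.sub h2).congr_deriv ?_
      rw [Finset.sum_range_succ', mul_sub, Finset.mul_sum]
      have : ∀ n ∈ Finset.range N, (genBinom a (n + 1) : ℂ) *
          (((n + 1 : ℕ) : ℂ) * (ε * v) ^ (n + 1 - 1) * ε) =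
          ε * a * ((genBinom (a - 1) n : ℂ) * (ε * v) ^ n) := by
        intro n _
        have h := congrArg (fun r : ℝ => (r : ℂ)) (genBinom_succ a n)
        push_cast at h ⊢
        linear_combination (ε * v) ^ n * ε * h
      rw [Finset.sum_congr rfl this]
      push_cast
      ring
    have hcont : ContinuousOn (fun v : ℝ => ε * a * ((1 + ε * (v : ℂ)) ^ ((a - 1 : ℝ) : ℂ) -
        ∑ n ∈ Finset.range N, (genBinom (a - 1) n : ℂ) * (ε * v) ^ n)) (Set.uIcc 0 y) := by
      rw [Set.uIcc_of_le hy]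
      refine continuousOn_const.mul (ContinuousOn.sub ?_ (by fun_prop))
      exact ContinuousOn.cpow_const (by fun_prop) fun v hv => one_add_mem_slitPlane hε hv.1
    have hftc := intervalIntegral.integral_eq_sub_of_hasDerivAt (a := 0) (b := y) (f := f)
      (fun v hv => hd v (by rw [Set.uIcc_of_le hy] at hv; exact hv.1)) hcont.intervalIntegrable
    have hf0 : f 0 = 0 := by
      simp [hf, Finset.sum_range_succ', genBinom_zero]
    have hint : ∫ v in (0 : ℝ)..y, ε * a * ((1 + ε * (v : ℂ)) ^ ((a - 1 : ℝ) : ℂ) -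
        ∑ n ∈ Finset.range N, (genBinom (a - 1) n : ℂ) * (ε * v) ^ n) =
        ∫ v in (0 : ℝ)..y, ε * a * (genBinom (a - 1) N * ε ^ N) *
          taylorKernel ε ((N + 1 : ℕ) - a) N v := by
      refine intervalIntegral.integral_congr fun v hv => ?_
      rw [Set.uIcc_of_le hy] at hv
      have h := ih (a - 1) hv.1
      have h' : (N : ℝ) - (a - 1) = (N + 1 : ℕ) - a := by push_cast; ring
      rw [h'] at h
      simp only [h]
      ring
    rw [hint, intervalIntegral.integral_const_mul, hf0, sub_zero] at hftc
    have hq : taylorKernel ε ((N + 1 : ℕ) - a) (N + 1) y =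
        (N + 1) * ∫ v in (0 : ℝ)..y, taylorKernel ε ((N + 1 : ℕ) - a) N v := rfl
    have h := congrArg (fun r : ℝ => (r : ℂ)) (genBinom_succ a N)
    push_cast at h
    have hfy : (1 + ε * (y : ℂ)) ^ (a : ℂ) =
        ∑ n ∈ Finset.range (N + 1), (genBinom a n : ℂ) * (ε * y) ^ n + f y := by
      simp [hf]
    rw [hfy, ← hftc, hq]
    linear_combination (-ε ^ (N + 1) * ∫ v in (0 : ℝ)..y, taylorKernel ε ((N + 1 : ℕ) - a) N v) * h

/-- For `b = N - a > 0` this makes the Taylor remainder of `(1 + ε y)^a` smaller in modulus than the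
first omitted term. -/
theorem norm_taylorKernel_lt {ε : ℂ} (hε : 0 ≤ ε.re) (hε1 : ‖ε‖ = 1) {b : ℝ} (hb : 0 < b)
    (N : ℕ) {y : ℝ} (hy : 0 < y) : ‖taylorKernel ε b N y‖ < y ^ N := by
  induction N generalizing y with
  | zero =>
    rw [taylorKernel_zero_of_nonneg _ _ hy.le, pow_zero, ← Complex.ofReal_neg,
      Complex.norm_cpow_real]
    exact Real.rpow_lt_one_of_one_lt_of_neg (one_lt_norm_one_add hε hε1 hy) (by linarith)
  | succ N ih =>
    have hc := continuous_taylorKernel hε b N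
    have hle : ∀ v ∈ Set.Ioc 0 y, ‖taylorKernel ε b N v‖ ≤ v ^ N := fun v hv => (ih hv.1).le
    have h1 : ‖∫ v in (0 : ℝ)..y, taylorKernel ε b N v‖ < ∫ v in (0 : ℝ)..y, v ^ N :=
      (intervalIntegral.norm_integral_le_integral_norm hy.le).trans_lt
        (intervalIntegral.integral_lt_integral_of_continuousOn_of_le_of_exists_lt hy
          hc.norm.continuousOn (by fun_prop) hle ⟨y, Set.right_mem_Icc.2 hy.le, ih hy⟩)
    have h2 : ∫ v in (0 : ℝ)..y, v ^ N = y ^ (N + 1) / (N + 1) := by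
      simp [integral_pow]
    have hN : (0 : ℝ) < N + 1 := by positivity
    have h3 : ‖((N : ℂ) + 1)‖ = (N : ℝ) + 1 := by
      rw [← Nat.cast_succ, Complex.norm_natCast]; push_cast; ring
    rw [taylorKernel, norm_mul, h3]
    rw [h2, lt_div_iff₀ hN] at h1
    linarith

/-- Positivity of the real part passes on to the higher primitives. -/
theorem re_taylorKernel_pos_of_le {ε : ℂ} (hε : 0 ≤ ε.re) {b : ℝ} {j N : ℕ} (hjN : j ≤ N)
    (hj : ∀ y : ℝ, 0 < y → 0 < (taylorKernel ε b j y).re) {y : ℝ} (hy : 0 < y) :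
    0 < (taylorKernel ε b N y).re := by
  induction N, hjN using Nat.le_induction generalizing y with
  | base => exact hj y hy
  | succ N _ ih =>
    have hc := continuous_taylorKernel hε b N
    have h1 : (∫ v in (0 : ℝ)..y, taylorKernel ε b N v).re =
        ∫ v in (0 : ℝ)..y, (taylorKernel ε b N v).re :=
      (Complex.reCLM.intervalIntegral_comp_comm (hc.intervalIntegrable 0 y)).symm
    have h2 : 0 < ∫ v in (0 : ℝ)..y, (taylorKernel ε b N v).re :=
      intervalIntegral.intervalIntegral_pos_of_pos_on
        ((Complex.continuous_re.comp hc).intervalIntegrable 0 y) (fun v hv => ih hv.1) hy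
    have h3 : ((N : ℂ) + 1) = (((N : ℝ) + 1 : ℝ) : ℂ) := by push_cast; ring
    rw [taylorKernel, h3, Complex.re_ofReal_mul, h1]
    positivity

theorem re_taylorKernel_one_pos (b : ℝ) (N : ℕ) {y : ℝ} (hy : 0 < y) :
    0 < (taylorKernel 1 b N y).re := by
  refine re_taylorKernel_pos_of_le (by simp) (Nat.zero_le N) (fun v hv => ?_) hy
  have h : (1 : ℂ) + 1 * (v : ℂ) = ((1 + v : ℝ) : ℂ) := by push_cast; ring
  rw [taylorKernel_zero_of_nonneg _ _ hv.le, h, ← Complex.ofReal_neg,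
    ← Complex.ofReal_cpow (by positivity), Complex.ofReal_re]
  positivity

theorem arg_one_add_I_mul_mem {y : ℝ} (hy : 0 < y) :
    0 < (1 + Complex.I * (y : ℂ)).arg ∧ (1 + Complex.I * (y : ℂ)).arg < Real.pi / 2 := by
  have hre : (1 + Complex.I * (y : ℂ)).re = 1 := by simp
  have him : (1 + Complex.I * (y : ℂ)).im = y := by simp
  constructor
  · refine lt_of_le_of_ne (Complex.arg_nonneg_iff.2 (by rw [him]; exact hy.le)) fun h => ?_
    have := (Complex.arg_eq_zero_iff.1 h.symm).2
    rw [him] at this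
    exact hy.ne' this
  · exact (abs_lt.1 (Complex.abs_arg_lt_pi_div_two_iff.2 (Or.inl (hre ▸ one_pos)))).2

/-- On the imaginary axis the real part of the iterated primitives is positive. For `b ≤ 1` this
holds from `N = 0` on; for `1 < b ≤ 2` and for `2 < b` it is read off from the closed forms of
`q₁` and of `q₂` that Taylor's formula provides. -/
theorem re_taylorKernel_I_pos {b : ℝ} (hb : 0 < b) {N : ℕ} (hN : 1 ≤ N) (hbN : b ≤ 2 ∨ 2 ≤ N)
    {y : ℝ} (hy : 0 < y) : 0 < (taylorKernel Complex.I b N y).re := by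
  have hI : 0 ≤ Complex.I.re := by simp
  rcases le_or_gt b 1 with hb1 | hb1
  · refine re_taylorKernel_pos_of_le hI (Nat.zero_le N) (fun v hv => ?_) hy
    obtain ⟨h1, h2⟩ := arg_one_add_I_mul_mem hv
    have hn := one_lt_norm_one_add hI Complex.norm_I hv
    rw [taylorKernel_zero_of_nonneg _ _ hv.le, ← Complex.ofReal_neg, Complex.cpow_ofReal_re]
    refine mul_pos (Real.rpow_pos_of_pos (by linarith) _) (Real.cos_pos_of_mem_Ioo ⟨?_, ?_⟩)
    · nlinarith
    · nlinarith
  rcases le_or_gt b 2 with hb2 | hb2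
  · refine re_taylorKernel_pos_of_le hI hN (fun v hv => ?_) hy
    obtain ⟨h1, h2⟩ := arg_one_add_I_mul_mem hv
    have hn := one_lt_norm_one_add hI Complex.norm_I hv
    have ht := one_add_cpow_taylor hI 1 (1 - b) hv.le
    have hbin : genBinom (1 - b) 1 = 1 - b := by simp [genBinom]
    simp only [Finset.range_one, Finset.sum_singleton, genBinom_zero, hbin, pow_zero, mul_one,
      pow_one, Nat.cast_one, sub_sub_cancel] at ht
    have him := congrArg Complex.im ht
    rw [Complex.cpow_ofReal_im, Complex.add_im, mul_assoc, Complex.im_ofReal_mul,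
      Complex.I_mul_im] at him
    simp only [Complex.ofReal_one, Complex.one_im, zero_add] at him
    have hs : Real.sin ((1 + Complex.I * (v : ℂ)).arg * (1 - b)) < 0 :=
      Real.sin_neg_of_neg_of_neg_pi_lt (by nlinarith) (by nlinarith)
    have hneg : (1 - b) * (taylorKernel Complex.I b 1 v).re < 0 := by
      rw [← him]
      exact mul_neg_of_pos_of_neg (Real.rpow_pos_of_pos (by linarith) _) hs
    by_contra! h
    nlinarith
  · have h2N : 2 ≤ N := hbN.resolve_left (by linarith)
    refine re_taylorKernel_pos_of_le hI h2N (fun v hv => ?_) hy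
    have hn := one_lt_norm_one_add hI Complex.norm_I hv
    have ht := one_add_cpow_taylor hI 2 (2 - b) hv.le
    have hbin : genBinom (2 - b) 1 = 2 - b := by simp [genBinom]
    have hbin2 : genBinom (2 - b) 2 = (2 - b) * (1 - b) / 2 := by
      simp only [genBinom, Finset.prod_range_succ, Finset.prod_range_zero, Nat.factorial]
      push_cast
      ring
    rw [Finset.sum_range_succ, Finset.sum_range_one, genBinom_zero, hbin, hbin2,
      Complex.I_sq] at ht
    simp only [Nat.cast_ofNat, sub_sub_cancel] at ht
    have hre := congrArg Complex.re ht
    have e : (((2 - b : ℝ) : ℂ) * (Complex.I * v) ^ 1).re = 0 := by simp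
    have e' : ((((2 - b) * (1 - b) / 2 : ℝ) : ℂ) * -1 * taylorKernel Complex.I b 2 v).re =
        -((2 - b) * (1 - b) / 2) * (taylorKernel Complex.I b 2 v).re := by
      rw [mul_neg_one, ← Complex.ofReal_neg, Complex.re_ofReal_mul]
    rw [Complex.add_re, Complex.add_re, e, e'] at hre
    have hlt : ((1 + Complex.I * (v : ℂ)) ^ ((2 - b : ℝ) : ℂ)).re < 1 := by
      refine (Complex.re_le_norm _).trans_lt ?_
      rw [Complex.norm_cpow_real]
      exact Real.rpow_lt_one_of_one_lt_of_neg hn (by linarith)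
    rw [hre] at hlt
    simp at hlt
    have hp : 0 < (2 - b) * (1 - b) := mul_pos_of_neg_of_neg (by linarith) (by linarith)
    by_contra! h
    nlinarith

open MeasureTheory Set

/-! ### The Laplace integral and its asymptotic expansion -/

/-- The Laplace integral `∫₀^∞ e^(-u) u^a (1 + u ζ)^a du`, with which `K_ν` and the Hankel function
`J_ν + i Y_ν` are expressed for `a = |ν| - 1/2`. -/
noncomputable def hankelIntegral (a : ℝ) (ζ : ℂ) : ℂ :=
  ∫ u in Ioi (0 : ℝ), ((Real.exp (-u) * u ^ a : ℝ) : ℂ) * (1 + u * ζ) ^ (a : ℂ)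

theorem integrableOn_exp_neg_mul_rpow {a : ℝ} (ha : -1 < a) :
    IntegrableOn (fun u : ℝ => Real.exp (-u) * u ^ a) (Ioi 0) := by
  have := Real.GammaIntegral_convergent (s := a + 1) (by linarith)
  simpa using this

theorem integral_exp_neg_mul_rpow_eq_Gamma {a : ℝ} (ha : -1 < a) :
    ∫ u in Ioi (0 : ℝ), Real.exp (-u) * u ^ a = Real.Gamma (a + 1) := by
  rw [Real.Gamma_eq_integral (by linarith)]
  simp

theorem one_add_mul_pow_le (R : ℝ) (hR : 0 < R) (m : ℕ) :
    ∃ C : ℝ, ∀ u : ℝ, 0 ≤ u → (1 + u * R) ^ m ≤ C * Real.exp (u / 2) := by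
  refine ⟨(2 * R) ^ m * m.factorial * Real.exp (1 / (2 * R)), fun u hu => ?_⟩
  have h := Real.pow_div_factorial_le_exp ((1 + u * R) / (2 * R)) (by positivity) m
  have h2 : (1 + u * R) / (2 * R) = 1 / (2 * R) + u / 2 := by field_simp
  rw [div_pow, div_div, div_le_iff₀ (by positivity), h2, Real.exp_add] at h
  linarith

theorem one_le_norm_one_add_mul {ζ : ℂ} (hζ : 0 ≤ ζ.re) {u : ℝ} (hu : 0 ≤ u) :
    1 ≤ ‖1 + (u : ℂ) * ζ‖ := by
  rw [mul_comm]
  exact (one_le_re_one_add hζ hu).trans (Complex.re_le_norm _)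

theorem norm_one_add_mul_cpow_le {ζ : ℂ} (hζ : 0 ≤ ζ.re) {R : ℝ} (hR : ‖ζ‖ ≤ R) {u : ℝ}
    (hu : 0 ≤ u) {c : ℝ} {m : ℕ} (hc : c ≤ m) :
    ‖(1 + (u : ℂ) * ζ) ^ (c : ℂ)‖ ≤ (1 + u * R) ^ m := by
  have h1 := one_le_norm_one_add_mul hζ hu
  rw [Complex.norm_cpow_real, ← Real.rpow_natCast]
  refine (Real.rpow_le_rpow_of_exponent_le h1 hc).trans
    (Real.rpow_le_rpow (by linarith) ?_ (by positivity))
  refine (norm_add_le _ _).trans ?_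
  rw [norm_one, norm_mul, Complex.norm_real, Real.norm_of_nonneg hu]
  gcongr

/-- One integrable function dominates the integrands of `hankelIntegral`, and those of their
derivatives in `ζ`, for all `a` and `ζ` in bounded ranges. -/
theorem exists_bound_hankelIntegrand (R : ℝ) (hR : 1 ≤ R) (m : ℕ) :
    ∃ g : ℝ → ℝ, IntegrableOn g (Ioi 0) ∧ ∀ u : ℝ, 0 < u → ∀ a c : ℝ, -(1 / 2) ≤ a → a ≤ m →
      c ≤ m → ∀ ζ : ℂ, 0 ≤ ζ.re → ‖ζ‖ ≤ R →
        (1 + u) * ‖((Real.exp (-u) * u ^ a : ℝ) : ℂ) * (1 + u * ζ) ^ (c : ℂ)‖ ≤ g u := by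
  obtain ⟨C, hC⟩ := one_add_mul_pow_le R (by linarith) (1 + (m + 1) + m)
  refine ⟨fun u => C * (u ^ (-(1 / 2) : ℝ) * Real.exp (-(1 / 2) * u ^ (1 : ℝ))),
    (integrableOn_rpow_mul_exp_neg_mul_rpow (by norm_num) one_pos (by norm_num)).const_mul C,
    fun u hu a c ha ham hc ζ hζ hζR => ?_⟩
  have h1 : 1 + u ≤ 1 + u * R := by nlinarith
  have h2 : u ^ a ≤ u ^ (-(1 / 2) : ℝ) * (1 + u * R) ^ (m + 1) := by
    have : u ^ a = u ^ (-(1 / 2) : ℝ) * u ^ (a + 1 / 2) := by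
      rw [← Real.rpow_add hu]; congr 1; ring
    rw [this]
    refine mul_le_mul_of_nonneg_left ?_ (by positivity)
    calc u ^ (a + 1 / 2) ≤ (1 + u * R) ^ (a + 1 / 2) :=
          Real.rpow_le_rpow hu.le (by nlinarith) (by linarith)
      _ ≤ (1 + u * R) ^ ((m + 1 : ℕ) : ℝ) :=
          Real.rpow_le_rpow_of_exponent_le (by nlinarith) (by push_cast; linarith)
      _ = _ := Real.rpow_natCast _ _
  have h3 := norm_one_add_mul_cpow_le hζ hζR hu.le hc
  have h4 : Real.exp (-u) * Real.exp (u / 2) = Real.exp (-(1 / 2) * u ^ (1 : ℝ)) := by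
    rw [← Real.exp_add, Real.rpow_one]; congr 1; ring
  have hpos : 0 ≤ 1 + u * R := by nlinarith
  rw [norm_mul, Complex.norm_real, Real.norm_of_nonneg (by positivity)]
  calc (1 + u) * (Real.exp (-u) * u ^ a * ‖(1 + (u : ℂ) * ζ) ^ (c : ℂ)‖)
      ≤ (1 + u * R) * (Real.exp (-u) * (u ^ (-(1 / 2) : ℝ) * (1 + u * R) ^ (m + 1)) *
          (1 + u * R) ^ m) := by gcongr
    _ = u ^ (-(1 / 2) : ℝ) * Real.exp (-u) * (1 + u * R) ^ (1 + (m + 1) + m) := by ring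
    _ ≤ u ^ (-(1 / 2) : ℝ) * Real.exp (-u) * (C * Real.exp (u / 2)) := by
          gcongr
          exact hC u hu.le
    _ = C * (u ^ (-(1 / 2) : ℝ) * (Real.exp (-u) * Real.exp (u / 2))) := by ring
    _ = _ := by rw [h4]

theorem one_add_mul_mem_slitPlane {ζ : ℂ} (hζ : 0 ≤ ζ.re) {u : ℝ} (hu : 0 ≤ u) :
    1 + (u : ℂ) * ζ ∈ Complex.slitPlane := by
  rw [mul_comm]
  exact one_add_mem_slitPlane hζ hu

theorem aestronglyMeasurable_hankelIntegrand (a c : ℝ) {ζ : ℂ} (hζ : 0 ≤ ζ.re) :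
    AEStronglyMeasurable
      (fun u : ℝ => ((Real.exp (-u) * u ^ a : ℝ) : ℂ) * (1 + u * ζ) ^ (c : ℂ))
      (volume.restrict (Ioi 0)) := by
  refine ContinuousOn.aestronglyMeasurable (ContinuousOn.mul ?_ ?_) measurableSet_Ioi
  · refine Complex.continuous_ofReal.comp_continuousOn (ContinuousOn.mul (by fun_prop) ?_)
    exact ContinuousOn.rpow_const continuousOn_id fun u hu => Or.inl (ne_of_gt hu)
  · exact ContinuousOn.cpow_const (by fun_prop) fun u hu =>
      one_add_mul_mem_slitPlane hζ (le_of_lt hu)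

theorem integrableOn_hankelIntegrand {a : ℝ} (ha : -(1 / 2) ≤ a) (c : ℝ) {ζ : ℂ}
    (hζ : 0 ≤ ζ.re) :
    IntegrableOn (fun u : ℝ => ((Real.exp (-u) * u ^ a : ℝ) : ℂ) * (1 + u * ζ) ^ (c : ℂ))
      (Ioi 0) := by
  obtain ⟨m, hm⟩ := exists_nat_ge (max a c)
  obtain ⟨g, hg, hb⟩ := exists_bound_hankelIntegrand (max 1 ‖ζ‖) (le_max_left _ _) m
  refine Integrable.mono' hg (aestronglyMeasurable_hankelIntegrand a c hζ) ?_
  filter_upwards [ae_restrict_mem measurableSet_Ioi] with u hu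
  have hu : (0 : ℝ) < u := hu
  have := hb u hu a c ha ((le_max_left _ _).trans hm) ((le_max_right _ _).trans hm) ζ hζ
    (le_max_right _ _)
  refine le_trans ?_ this
  exact le_mul_of_one_le_left (norm_nonneg _) (by linarith)

theorem differentiableAt_hankelIntegral {a : ℝ} (ha : -(1 / 2) ≤ a) {ζ : ℂ} (hζ : 0 < ζ.re) :
    DifferentiableAt ℂ (hankelIntegral a) ζ := by
  obtain ⟨m, hm⟩ := exists_nat_ge a
  obtain ⟨g, hg, hb⟩ := exists_bound_hankelIntegrand (‖ζ‖ + 1)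
    (by linarith [norm_nonneg ζ]) m
  have hre : ∀ᶠ z : ℂ in 𝓝 ζ, 0 < z.re :=
    Complex.continuous_re.continuousAt.eventually (lt_mem_nhds hζ)
  have hs : {z : ℂ | 0 < z.re} ∩ Metric.ball ζ 1 ∈ 𝓝 ζ :=
    inter_mem hre (Metric.ball_mem_nhds ζ one_pos)
  refine (hasDerivAt_integral_of_dominated_loc_of_deriv_le (𝕜 := ℂ)
    (bound := fun u => |a| * g u) (s := {z : ℂ | 0 < z.re} ∩ Metric.ball ζ 1)
    (F := fun z u => ((Real.exp (-u) * u ^ a : ℝ) : ℂ) * (1 + u * z) ^ (a : ℂ))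
    (F' := fun z u => ((Real.exp (-u) * u ^ a : ℝ) : ℂ) *
      (a * (1 + u * z) ^ ((a : ℂ) - 1) * u)) hs ?_ ?_ ?_ ?_ ?_ ?_).2.differentiableAt
  · exact hre.mono fun z hz => aestronglyMeasurable_hankelIntegrand a a (le_of_lt hz)
  · exact integrableOn_hankelIntegrand ha a hζ.le
  · have h1 := (aestronglyMeasurable_hankelIntegrand a (a - 1) hζ.le).mul
      (Continuous.aestronglyMeasurable (f := fun u : ℝ => (a : ℂ) * u) (by fun_prop))
    refine h1.congr (Eventually.of_forall fun u => ?_)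
    simp only [Pi.mul_apply]
    push_cast
    ring
  · filter_upwards [ae_restrict_mem measurableSet_Ioi] with u hu z hz
    have hu : (0 : ℝ) < u := hu
    have hzR : ‖z‖ ≤ ‖ζ‖ + 1 := by
      have h := mem_ball_iff_norm.1 hz.2
      have := norm_le_norm_add_norm_sub' z ζ
      linarith
    have h := hb u hu a (a - 1) ha hm (by linarith) z (le_of_lt hz.1) hzR
    rw [norm_mul, Complex.ofReal_sub, Complex.ofReal_one] at h
    rw [norm_mul, norm_mul _ (u : ℂ), norm_mul (a : ℂ), Complex.norm_real u, Complex.norm_real a,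
      Real.norm_eq_abs a, Real.norm_of_nonneg hu.le]
    set A := ‖((Real.exp (-u) * u ^ a : ℝ) : ℂ)‖
    set B := ‖(1 + (u : ℂ) * z) ^ ((a : ℂ) - 1)‖
    have hAB : 0 ≤ A * B := by positivity
    have : u * (A * B) ≤ g u := by nlinarith
    calc A * (|a| * B * u) = |a| * (u * (A * B)) := by ring
      _ ≤ _ := by gcongr
  · exact hg.const_mul _
  · filter_upwards [ae_restrict_mem measurableSet_Ioi] with u hu z hz
    have h0 : HasDerivAt (fun w : ℂ => w ^ (a : ℂ)) _ (1 + (u : ℂ) * z) :=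
      (hasDerivAt_id (1 + (u : ℂ) * z)).cpow_const
        (one_add_mul_mem_slitPlane (le_of_lt hz.1) (le_of_lt hu))
    have hl : HasDerivAt (fun z : ℂ => 1 + (u : ℂ) * z) u z := by
      simpa using ((hasDerivAt_id z).const_mul (u : ℂ)).const_add 1
    exact ((HasDerivAt.comp (h := fun z : ℂ => 1 + (u : ℂ) * z) z h0 hl).const_mul _).congr_deriv
      (by simp)

/-- Joint continuity in the order and in `ζ`, up to the imaginary axis, on which the Hankel function
has its Laplace integral. -/
theorem continuousWithinAt_hankelIntegral (ν : ℝ) {ζ : ℂ} (hζ : 0 ≤ ζ.re) :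
    ContinuousWithinAt (fun p : ℝ × ℂ => hankelIntegral (|p.1| - 1 / 2) p.2)
      {p | 0 ≤ p.2.re} (ν, ζ) := by
  obtain ⟨m, hm⟩ := exists_nat_ge (|ν| + 1)
  obtain ⟨g, hg, hb⟩ := exists_bound_hankelIntegrand (‖ζ‖ + 1)
    (by linarith [norm_nonneg ζ]) m
  have hp1 : ∀ᶠ p : ℝ × ℂ in 𝓝[{p | 0 ≤ p.2.re}] (ν, ζ), |p.1| < |ν| + 1 :=
    nhdsWithin_le_nhds ((continuous_abs.comp continuous_fst).continuousAt.eventually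
      (gt_mem_nhds (by simp)))
  have hp2 : ∀ᶠ p : ℝ × ℂ in 𝓝[{p | 0 ≤ p.2.re}] (ν, ζ), ‖p.2‖ < ‖ζ‖ + 1 :=
    nhdsWithin_le_nhds ((continuous_norm.comp continuous_snd).continuousAt.eventually
      (gt_mem_nhds (by simp)))
  have hp3 : ∀ᶠ p : ℝ × ℂ in 𝓝[{p | 0 ≤ p.2.re}] (ν, ζ), 0 ≤ p.2.re := self_mem_nhdsWithin
  refine tendsto_integral_filter_of_dominated_convergence g ?_ ?_ hg ?_
  · exact hp3.mono fun p hp => aestronglyMeasurable_hankelIntegrand _ _ hp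
  · filter_upwards [hp1, hp2, hp3] with p h1 h2 h3
    filter_upwards [ae_restrict_mem measurableSet_Ioi] with u hu
    have hu : (0 : ℝ) < u := hu
    have h0 := abs_nonneg p.1
    refine le_trans ?_ (hb u hu (|p.1| - 1 / 2) (|p.1| - 1 / 2) (by linarith) (by linarith)
      (by linarith) p.2 h3 h2.le)
    exact le_mul_of_one_le_left (norm_nonneg _) (by linarith)
  · filter_upwards [ae_restrict_mem measurableSet_Ioi] with u hu
    have hu : (0 : ℝ) < u := hu
    have hc : ContinuousAt (fun p : ℝ × ℂ => ((Real.exp (-u) * u ^ (|p.1| - 1 / 2) : ℝ) : ℂ) *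
        (1 + u * p.2) ^ ((|p.1| - 1 / 2 : ℝ) : ℂ)) (ν, ζ) := by
      refine ContinuousAt.mul ?_ (ContinuousAt.cpow (by fun_prop) (by fun_prop)
        (one_add_mul_mem_slitPlane hζ hu.le))
      refine Complex.continuous_ofReal.continuousAt.comp (continuousAt_const.mul ?_)
      exact ContinuousAt.rpow continuousAt_const (by fun_prop) (Or.inl hu.ne')
    exact hc.tendsto.mono_left nhdsWithin_le_nhds

/-- The asymptotic expansion of `hankelIntegral a (ε h)` with its remainder. The latter is the first
omitted term times a weighted mean `Θ` of the values `q_N(y) / y^N`. -/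
theorem hankelIntegral_expansion {ε : ℂ} (hε : 0 ≤ ε.re) (hε1 : ‖ε‖ = 1) {a : ℝ}
    (ha : -(1 / 2) ≤ a) {N : ℕ} (haN : a < N)
    (hpos : ∀ y : ℝ, 0 < y → 0 < (taylorKernel ε (N - a) N y).re) {h : ℝ} (hh : 0 < h) :
    ∃ Θ : ℂ, 0 < Θ.re ∧ Θ.re < 1 ∧ hankelIntegral a (ε * h) =
      ∑ n ∈ Finset.range N, ((genBinom a n * Real.Gamma (a + n + 1) * h ^ n : ℝ) : ℂ) * ε ^ n +
        ((genBinom a N * Real.Gamma (a + N + 1) * h ^ N : ℝ) : ℂ) * ε ^ N * Θ := by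
  have hb : 0 < (N : ℝ) - a := by linarith
  have hint : ∀ n : ℕ, IntegrableOn (fun u : ℝ => Real.exp (-u) * u ^ (a + n)) (Ioi 0) :=
    fun n => integrableOn_exp_neg_mul_rpow (by have : (0 : ℝ) ≤ n := n.cast_nonneg; linarith)
  set q : ℝ → ℂ := fun u => taylorKernel ε (N - a) N (u * h) with hq
  have hqc : Continuous q := (continuous_taylorKernel hε _ _).comp (by fun_prop)
  have hqn : ∀ u : ℝ, 0 < u → ‖q u‖ < u ^ N * h ^ N := fun u hu => by
    rw [← mul_pow]
    exact norm_taylorKernel_lt hε hε1 hb N (by positivity)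
  have hw : ∀ u : ℝ, 0 < u → ∀ n : ℕ, Real.exp (-u) * u ^ a * u ^ n =
      Real.exp (-u) * u ^ (a + n) := fun u hu n => by
    rw [Real.rpow_add hu, Real.rpow_natCast, mul_assoc]
  have hqi : IntegrableOn (fun u : ℝ => ((Real.exp (-u) * u ^ a : ℝ) : ℂ) * q u) (Ioi 0) := by
    refine Integrable.mono' ((hint N).mul_const (h ^ N)) ?_ ?_
    · refine AEStronglyMeasurable.mul ?_ hqc.aestronglyMeasurable
      refine ContinuousOn.aestronglyMeasurable ?_ measurableSet_Ioi
      refine Complex.continuous_ofReal.comp_continuousOn (ContinuousOn.mul (by fun_prop) ?_)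
      exact ContinuousOn.rpow_const continuousOn_id fun u hu => Or.inl (ne_of_gt hu)
    · filter_upwards [ae_restrict_mem measurableSet_Ioi] with u hu
      have hu : (0 : ℝ) < u := hu
      rw [norm_mul, Complex.norm_real, Real.norm_of_nonneg (by positivity), ← hw u hu,
        mul_assoc _ (u ^ N)]
      exact mul_le_mul_of_nonneg_left (hqn u hu).le (by positivity)
  set Φ : ℂ := ∫ u in Ioi (0 : ℝ), ((Real.exp (-u) * u ^ a : ℝ) : ℂ) * q u with hΦ
  have hΦre : Φ.re = ∫ u in Ioi (0 : ℝ), Real.exp (-u) * u ^ a * (q u).re := by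
    rw [hΦ, ← Complex.reCLM_apply, ← Complex.reCLM.integral_comp_comm hqi]
    simp only [Complex.reCLM_apply, Complex.re_ofReal_mul]
  have hrei : IntegrableOn (fun u : ℝ => Real.exp (-u) * u ^ a * (q u).re) (Ioi 0) := by
    refine (Complex.reCLM.integrable_comp hqi).congr (Eventually.of_forall fun u => ?_)
    simp only [Complex.reCLM_apply, Complex.re_ofReal_mul]
  have hsupp : ∀ f : ℝ → ℝ, IntegrableOn f (Ioi 0) → (∀ u, 0 < u → 0 < f u) →
      0 < ∫ u in Ioi (0 : ℝ), f u := by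
    intro f hf hfpos
    rw [setIntegral_pos_iff_support_of_nonneg_ae _ hf]
    · have : Function.support f ∩ Ioi 0 = Ioi 0 :=
        inter_eq_right.2 fun u hu => (hfpos u hu).ne'
      rw [this, Real.volume_Ioi]
      exact ENNReal.zero_lt_top
    · filter_upwards [ae_restrict_mem measurableSet_Ioi] with u hu using (hfpos u hu).le
  have hΦ0 : 0 < Φ.re := by
    rw [hΦre]
    refine hsupp _ hrei fun u hu => ?_
    have := hpos (u * h) (by positivity)
    positivity
  have hG : 0 < Real.Gamma (a + N + 1) :=
    Real.Gamma_pos_of_pos (by have : (0 : ℝ) ≤ N := N.cast_nonneg; linarith)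
  have hIN : ∫ u in Ioi (0 : ℝ), Real.exp (-u) * u ^ (a + N) * h ^ N =
      Real.Gamma (a + N + 1) * h ^ N := by
    rw [integral_mul_const, integral_exp_neg_mul_rpow_eq_Gamma
      (by have : (0 : ℝ) ≤ N := N.cast_nonneg; linarith)]
  have hΦ1 : Φ.re < Real.Gamma (a + N + 1) * h ^ N := by
    rw [← hIN, hΦre, ← sub_pos, ← integral_sub ((hint N).mul_const _) hrei]
    refine hsupp _ (((hint N).mul_const _).sub hrei) fun u hu => ?_
    have h1 := (Complex.re_le_norm (q u)).trans_lt (hqn u hu)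
    rw [← hw u hu, mul_assoc _ (u ^ N), ← mul_sub]
    have : 0 < u ^ N * h ^ N - (q u).re := by linarith
    positivity
  have hc : 0 < Real.Gamma (a + N + 1) * h ^ N := by positivity
  refine ⟨Φ / ((Real.Gamma (a + N + 1) * h ^ N : ℝ) : ℂ), ?_, ?_, ?_⟩
  · rw [Complex.div_ofReal_re]; positivity
  · rw [Complex.div_ofReal_re, div_lt_one hc]; exact hΦ1
  · have hpt : ∀ u ∈ Ioi (0 : ℝ), ((Real.exp (-u) * u ^ a : ℝ) : ℂ) * (1 + u * (ε * h)) ^ (a : ℂ) =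
        ∑ n ∈ Finset.range N, ((genBinom a n * h ^ n : ℝ) : ℂ) * ε ^ n *
          ((Real.exp (-u) * u ^ (a + n) : ℝ) : ℂ) +
        (genBinom a N : ℂ) * ε ^ N * (((Real.exp (-u) * u ^ a : ℝ) : ℂ) * q u) := by
      intro u hu
      have hu : (0 : ℝ) < u := hu
      have ht := one_add_cpow_taylor hε N a (y := u * h) (by positivity)
      have e : (1 : ℂ) + u * (ε * h) = 1 + ε * ((u * h : ℝ) : ℂ) := by push_cast; ring
      rw [e, ht, mul_add, Finset.mul_sum]
      congr 1
      · refine Finset.sum_congr rfl fun n _ => ?_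
        rw [← hw u hu n]
        push_cast
        ring
      · ring
    rw [hankelIntegral, setIntegral_congr_fun measurableSet_Ioi hpt, integral_add,
      integral_finsetSum, integral_const_mul, ← hΦ]
    · congr 1
      · refine Finset.sum_congr rfl fun n _ => ?_
        rw [integral_const_mul, integral_complex_ofReal, integral_exp_neg_mul_rpow_eq_Gamma
          (by have : (0 : ℝ) ≤ n := n.cast_nonneg; linarith)]
        push_cast
        ring
      · have : ((Real.Gamma (a + N + 1) * h ^ N : ℝ) : ℂ) ≠ 0 := by exact_mod_cast hc.ne'
        field_simp
        push_cast
        ring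
    · intro n _
      exact (hint n).ofReal.const_mul _
    · exact integrable_finsetSum _ fun n _ => (hint n).ofReal.const_mul _
    · exact hqi.const_mul _

/-! ### The Laplace integral of `K_ν` -/

theorem exists_exp_neg_mul_exp_add_le {r : ℝ} (hr : 0 < r) (a : ℝ) :
    ∃ C : ℝ, ∀ u : ℝ, 0 ≤ u → Real.exp (-(r * Real.exp u) + a * u) ≤ C * Real.exp (-u) := by
  set c : ℝ := (|a| + 1) ^ 2 / (2 * r) with hc
  refine ⟨Real.exp c, fun u hu => ?_⟩
  rw [← Real.exp_add, Real.exp_le_exp]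
  have h1 : u ^ 2 / 2 ≤ Real.exp u := by
    have := Real.quadratic_le_exp_of_nonneg hu
    linarith
  have h2 : a * u ≤ |a| * u := mul_le_mul_of_nonneg_right (le_abs_self a) hu
  have h3 : 0 ≤ (r * u - (|a| + 1)) ^ 2 / (2 * r) := by positivity
  have h4 : (r * u - (|a| + 1)) ^ 2 / (2 * r) = r * (u ^ 2 / 2) - (|a| + 1) * u + c := by
    rw [hc]; field_simp; ring
  have h5 : r * (u ^ 2 / 2) ≤ r * Real.exp u := mul_le_mul_of_nonneg_left h1 hr.le
  linarith

theorem integrableOn_exp_neg_mul_exp_add {r : ℝ} (hr : 0 < r) (a : ℝ) :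
    IntegrableOn (fun u : ℝ => Real.exp (-(r * Real.exp u) + a * u)) (Ioi 0) := by
  obtain ⟨C, hC⟩ := exists_exp_neg_mul_exp_add_le hr a
  refine Integrable.mono' ((integrableOn_exp_neg_Ioi 0).const_mul C)
    (Continuous.aestronglyMeasurable (by fun_prop)) ?_
  filter_upwards [ae_restrict_mem measurableSet_Ioi] with u hu
  rw [Real.norm_of_nonneg (by positivity)]
  exact hC u (le_of_lt hu)

theorem exp_half_le_sinh {t : ℝ} (ht : 0 ≤ t) : Real.exp t / 2 - 1 / 2 ≤ Real.sinh t := by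
  have : Real.exp (-t) ≤ 1 := Real.exp_le_one_iff.2 (by linarith)
  rw [Real.sinh_eq]
  linarith

theorem integrableOn_exp_neg_mul_sinh_add {x : ℝ} (hx : 0 < x) (a : ℝ) :
    IntegrableOn (fun t : ℝ => Real.exp (-(x * Real.sinh t) + a * t)) (Ioi 0) := by
  refine Integrable.mono' ((integrableOn_exp_neg_mul_exp_add (half_pos hx) a).const_mul
    (Real.exp (x / 2))) (Continuous.aestronglyMeasurable (by fun_prop)) ?_
  filter_upwards [ae_restrict_mem measurableSet_Ioi] with t ht
  rw [Real.norm_of_nonneg (by positivity), ← Real.exp_add, Real.exp_le_exp]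
  have := mul_le_mul_of_nonneg_left (exp_half_le_sinh (le_of_lt ht)) hx.le
  linarith

theorem integrableOn_exp_neg_mul_cosh_add {x : ℝ} (hx : 0 < x) (a : ℝ) :
    IntegrableOn (fun t : ℝ => Real.exp (-(x * Real.cosh t) + a * t)) (Ioi 0) := by
  refine Integrable.mono' (integrableOn_exp_neg_mul_sinh_add hx a)
    (Continuous.aestronglyMeasurable (by fun_prop)) ?_
  refine Eventually.of_forall fun t => ?_
  rw [Real.norm_of_nonneg (by positivity), Real.exp_le_exp]
  have := mul_le_mul_of_nonneg_left (Real.sinh_lt_cosh t).le hx.le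
  linarith

theorem integrable_exp_neg_mul_cosh_add {x : ℝ} (hx : 0 < x) (a : ℝ) :
    Integrable (fun t : ℝ => Real.exp (-(x * Real.cosh t) + a * t)) := by
  rw [← integrableOn_univ, ← Iic_union_Ioi (a := (0 : ℝ))]
  refine IntegrableOn.union ?_ (integrableOn_exp_neg_mul_cosh_add hx a)
  rw [integrableOn_Iic_iff_integrableOn_Iio]
  have h := (integrableOn_exp_neg_mul_cosh_add hx (-a)).comp_neg
  simpa [Real.cosh_neg] using h

theorem integrable_exp_neg_mul_cosh_mul_cosh {x : ℝ} (hx : 0 < x) (ν : ℝ) :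
    Integrable (fun t : ℝ => Real.exp (-(x * Real.cosh t)) * Real.cosh (ν * t)) := by
  have h := ((integrable_exp_neg_mul_cosh_add hx ν).add
    (integrable_exp_neg_mul_cosh_add hx (-ν))).div_const 2
  refine h.congr (Eventually.of_forall fun t => ?_)
  simp only [Pi.add_apply, Real.exp_add, Real.cosh_eq (ν * t), neg_mul]
  ring

theorem integral_exp_neg_mul_cosh_add {x : ℝ} (hx : 0 < x) (ν : ℝ) :
    ∫ t : ℝ, Real.exp (-(x * Real.cosh t) + ν * t) = 2 * besselK ν x := by
  have h1 : ∫ t : ℝ, Real.exp (-(x * Real.cosh t)) * Real.cosh (ν * t) = 2 * besselK ν x := by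
    rw [besselK, ← integral_comp_abs]
    refine integral_congr_ae (Eventually.of_forall fun t => ?_)
    rcases abs_choice t with h | h <;> simp [h, Real.cosh_neg]
  have h2 : ∫ t : ℝ, Real.exp (-(x * Real.cosh t) + -ν * t) =
      ∫ t : ℝ, Real.exp (-(x * Real.cosh t) + ν * t) := by
    rw [← integral_neg_eq_self]
    simp [Real.cosh_neg]
  have h3 : ∫ t : ℝ, Real.exp (-(x * Real.cosh t)) * Real.cosh (ν * t) =
      ∫ t : ℝ, (Real.exp (-(x * Real.cosh t) + ν * t) +
        Real.exp (-(x * Real.cosh t) + -ν * t)) / 2 := by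
    refine integral_congr_ae (Eventually.of_forall fun t => ?_)
    simp only [Real.exp_add, Real.cosh_eq (ν * t), neg_mul]
    ring
  rw [← h1, h3, integral_div, integral_add (integrable_exp_neg_mul_cosh_add hx ν)
    (integrable_exp_neg_mul_cosh_add hx (-ν)), h2]
  ring

theorem hasDerivAt_besselK (ν : ℝ) {x : ℝ} (hx : 0 < x) :
    HasDerivAt (besselK ν) (-(besselK (ν - 1) x + besselK (ν + 1) x) / 2) x := by
  have hprod : ∀ y t : ℝ, Real.exp (-(y * Real.cosh t)) * Real.cosh (ν * t) * Real.cosh t =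
      (Real.exp (-(y * Real.cosh t)) * Real.cosh ((ν - 1) * t) +
        Real.exp (-(y * Real.cosh t)) * Real.cosh ((ν + 1) * t)) / 2 := by
    intro y t
    rw [sub_mul, add_mul, one_mul, Real.cosh_sub, Real.cosh_add]
    ring
  have hi : ∀ y : ℝ, 0 < y → ∀ μ : ℝ, IntegrableOn
      (fun t : ℝ => Real.exp (-(y * Real.cosh t)) * Real.cosh (μ * t)) (Ioi 0) :=
    fun y hy μ => (integrable_exp_neg_mul_cosh_mul_cosh hy μ).integrableOn
  have h := hasDerivAt_integral_of_dominated_loc_of_deriv_le (𝕜 := ℝ)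
    (μ := volume.restrict (Ioi (0 : ℝ))) (s := Ioi (x / 2)) (x₀ := x)
    (bound := fun t => Real.exp (-(x / 2 * Real.cosh t)) * Real.cosh (ν * t) * Real.cosh t)
    (F := fun y t => Real.exp (-(y * Real.cosh t)) * Real.cosh (ν * t))
    (F' := fun y t => -(Real.exp (-(y * Real.cosh t)) * Real.cosh (ν * t) * Real.cosh t))
    (Ioi_mem_nhds (by linarith))
    (Eventually.of_forall fun y => Continuous.aestronglyMeasurable (by fun_prop))
    (hi x hx ν) (Continuous.aestronglyMeasurable (by fun_prop))
    (Eventually.of_forall fun t y hy => ?_) ?_ (Eventually.of_forall fun t y _ => ?_)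
  · refine h.2.congr_deriv ?_
    simp only [hprod]
    rw [integral_neg, integral_div, integral_add (hi x hx _) (hi x hx _), besselK, besselK]
    ring
  · have hc := Real.cosh_pos t
    have hc' := Real.cosh_pos (ν * t)
    rw [norm_neg, Real.norm_of_nonneg (by positivity)]
    have : -(y * Real.cosh t) ≤ -(x / 2 * Real.cosh t) := by
      have := mul_le_mul_of_nonneg_right (le_of_lt hy : x / 2 ≤ y) hc.le
      linarith
    gcongr
  · simp only [hprod]
    exact ((hi _ (half_pos hx) _).add (hi _ (half_pos hx) _)).div_const 2
  · have h1 : HasDerivAt (fun y : ℝ => -(y * Real.cosh t)) (-Real.cosh t) y := by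
      simpa using ((hasDerivAt_id y).mul_const (Real.cosh t)).fun_neg
    exact (h1.exp.mul_const _).congr_deriv (by ring)

/-- The case `ν = 1/2` of the integral for `K_ν`, by the substitution
`w = p e^(t/2) - q e^(-t/2)` and the symmetry that exchanges the two terms of `w`. -/
theorem integral_exp_neg_exp_sub_half {p q : ℝ} (hp : 0 < p) (hq : 0 < q) :
    Integrable (fun t : ℝ => Real.exp (-(p ^ 2 * Real.exp t) - q ^ 2 * Real.exp (-t) - t / 2)) ∧
    ∫ t : ℝ, Real.exp (-(p ^ 2 * Real.exp t) - q ^ 2 * Real.exp (-t) - t / 2) =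
      Real.sqrt Real.pi / q * Real.exp (-(2 * p * q)) := by
  set w : ℝ → ℝ := fun t => p * Real.exp (t / 2) - q * Real.exp (-(t / 2)) with hw
  set w' : ℝ → ℝ := fun t => (p * Real.exp (t / 2) + q * Real.exp (-(t / 2))) / 2 with hw'
  have hd : ∀ t ∈ (univ : Set ℝ), HasDerivWithinAt w (w' t) univ t := by
    intro t _
    have h1 : HasDerivAt (fun t : ℝ => t / 2) (1 / 2) t := (hasDerivAt_id t).div_const 2
    have h2 := (h1.exp.const_mul p).sub (h1.fun_neg.exp.const_mul q)
    refine (h2.congr_deriv ?_).hasDerivWithinAt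
    simp only [hw']
    ring
  have hmono : StrictMono w := by
    intro s t hst
    have h1 : Real.exp (s / 2) < Real.exp (t / 2) := Real.exp_lt_exp.2 (by linarith)
    have h2 : Real.exp (-(t / 2)) < Real.exp (-(s / 2)) := Real.exp_lt_exp.2 (by linarith)
    have h3 := mul_lt_mul_of_pos_left h1 hp
    have h4 := mul_lt_mul_of_pos_left h2 hq
    simp only [hw]
    linarith
  have hsurj : w '' univ = univ := by
    rw [image_univ]
    refine range_eq_univ.2 fun c => ?_
    set D := Real.sqrt (c ^ 2 + 4 * p * q) with hD
    have hD2 : D ^ 2 = c ^ 2 + 4 * p * q := Real.sq_sqrt (by positivity)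
    have hcD : 0 < c + D := by
      have h1 : |c| < D := by
        rw [← Real.sqrt_sq_eq_abs, hD]
        exact Real.sqrt_lt_sqrt (sq_nonneg c) (by have := mul_pos hp hq; linarith)
      linarith [neg_abs_le c]
    set s := (c + D) / (2 * p) with hs
    have hs0 : 0 < s := by positivity
    refine ⟨2 * Real.log s, ?_⟩
    have e : 2 * Real.log s / 2 = Real.log s := by ring
    simp only [hw, e, Real.exp_neg, Real.exp_log hs0]
    have : p * s ^ 2 - c * s - q = 0 := by
      rw [hs]
      field_simp
      linear_combination hD2
    field_simp
    linarith
  have hgi : Integrable (fun v : ℝ => Real.exp (-v ^ 2)) := by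
    simpa using integrable_exp_neg_mul_sq (b := 1) one_pos
  have hw'pos : ∀ t, 0 < w' t := fun t => by simp only [hw']; positivity
  have hI : Integrable (fun t => w' t * Real.exp (-(w t) ^ 2)) := by
    have := (integrableOn_image_iff_integrableOn_abs_deriv_smul MeasurableSet.univ hd
      hmono.injective.injOn (fun v : ℝ => Real.exp (-v ^ 2))).1
        (by rw [hsurj]; exact hgi.integrableOn)
    rw [integrableOn_univ] at this
    refine this.congr (Eventually.of_forall fun t => ?_)
    simp only [smul_eq_mul, abs_of_pos (hw'pos t)]
  have hV : ∫ t, w' t * Real.exp (-(w t) ^ 2) = Real.sqrt Real.pi := by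
    have := integral_image_eq_integral_abs_deriv_smul MeasurableSet.univ hd
      hmono.injective.injOn (fun v : ℝ => Real.exp (-v ^ 2))
    rw [hsurj, setIntegral_univ, setIntegral_univ] at this
    have hg := integral_gaussian 1
    simp only [div_one, neg_mul, one_mul] at hg
    rw [hg] at this
    rw [this]
    refine integral_congr_ae (Eventually.of_forall fun t => ?_)
    simp only [smul_eq_mul, abs_of_pos (hw'pos t)]
  have hsq : ∀ t, Real.exp (-(w t) ^ 2) =
      Real.exp (2 * p * q) * Real.exp (-(p ^ 2 * Real.exp t) - q ^ 2 * Real.exp (-t)) := by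
    intro t
    rw [← Real.exp_add]
    congr 1
    have h1 : Real.exp t = Real.exp (t / 2) ^ 2 := by
      rw [← Real.exp_nat_mul]; congr 1; push_cast; ring
    have h2 : Real.exp (-t) = Real.exp (-(t / 2)) ^ 2 := by
      rw [← Real.exp_nat_mul]; congr 1; push_cast; ring
    have h3 : Real.exp (t / 2) * Real.exp (-(t / 2)) = 1 := by rw [← Real.exp_add]; simp
    simp only [hw]
    rw [h1, h2]
    linear_combination (2 * p * q) * h3
  set f : ℝ → ℝ := fun t => q * Real.exp (-(t / 2)) * Real.exp (-(w t) ^ 2) with hf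
  have hfi : Integrable f := by
    refine Integrable.mono' (hI.const_mul 2) (Continuous.aestronglyMeasurable (by fun_prop))
      (Eventually.of_forall fun t => ?_)
    have : 0 ≤ p * Real.exp (t / 2) * Real.exp (-(w t) ^ 2) := by positivity
    rw [Real.norm_of_nonneg (by positivity)]
    simp only [hf, hw']
    linarith
  have hrefl : ∀ t, f (2 * Real.log (q / p) - t) =
      p * Real.exp (t / 2) * Real.exp (-(w t) ^ 2) := by
    intro t
    have e1 : Real.exp ((2 * Real.log (q / p) - t) / 2) = q / p * Real.exp (-(t / 2)) := by
      rw [← Real.exp_log (div_pos hq hp), ← Real.exp_add, Real.log_exp]; congr 1; ring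
    have e2 : Real.exp (-((2 * Real.log (q / p) - t) / 2)) = p / q * Real.exp (t / 2) := by
      rw [Real.exp_neg, e1, Real.exp_neg]; field_simp
    have e3 : w (2 * Real.log (q / p) - t) = -w t := by
      simp only [hw, e1, e2]; field_simp; ring
    simp only [hf]
    rw [e3, e2, neg_sq]
    field_simp
  have hfV : ∫ t, f t = Real.sqrt Real.pi := by
    have h1 : ∫ t, f (2 * Real.log (q / p) - t) = ∫ t, f t := integral_sub_left_eq_self f volume _
    have h2 : (∫ t, f t) + ∫ t, f (2 * Real.log (q / p) - t) = 2 * Real.sqrt Real.pi := by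
      rw [← integral_add hfi (hfi.comp_sub_left _), ← hV, ← integral_const_mul]
      refine integral_congr_ae (Eventually.of_forall fun t => ?_)
      simp only [hrefl]
      simp only [hf, hw']
      ring
    linarith
  have hgoal : (fun t : ℝ => Real.exp (-(p ^ 2 * Real.exp t) - q ^ 2 * Real.exp (-t) - t / 2)) =
      fun t => Real.exp (-(2 * p * q)) / q * f t := by
    ext t
    simp only [hf]
    rw [hsq, sub_eq_add_neg _ (t / 2), Real.exp_add, Real.exp_neg (2 * p * q)]
    field_simp
  rw [hgoal]
  refine ⟨hfi.const_mul _, ?_⟩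
  rw [integral_const_mul, hfV]
  ring

/-- The Gamma integral in the variable `q = u (1 + u / (2 x))`, for which `dq = (1 + u / x) du`. -/
theorem integral_mul_exp_neg_mul_exp {a : ℝ} (ha : -1 < a) {x : ℝ} (hx : 0 < x) (t : ℝ) :
    IntegrableOn (fun u : ℝ => (1 + u / x) * ((u * (1 + u / (2 * x))) ^ a *
      Real.exp (-(u * (1 + u / (2 * x)) * Real.exp (-t))))) (Ioi 0) ∧
    ∫ u in Ioi (0 : ℝ), (1 + u / x) * ((u * (1 + u / (2 * x))) ^ a *
      Real.exp (-(u * (1 + u / (2 * x)) * Real.exp (-t)))) =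
      Real.Gamma (a + 1) * Real.exp ((a + 1) * t) := by
  set Q : ℝ → ℝ := fun u => u * (1 + u / (2 * x)) with hQ
  have hd : ∀ u ∈ Ioi (0 : ℝ), HasDerivWithinAt Q (1 + u / x) (Ioi 0) u := by
    intro u _
    have h1 : HasDerivAt (fun u : ℝ => 1 + u / (2 * x)) (1 / (2 * x)) u :=
      ((hasDerivAt_id u).div_const (2 * x)).const_add 1
    refine (((hasDerivAt_id u).mul h1).congr_deriv ?_).hasDerivWithinAt
    simp only [id]
    field_simp
    ring
  have hinj : InjOn Q (Ioi 0) := by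
    refine StrictMonoOn.injOn fun s hs t ht hst => ?_
    have hs : (0 : ℝ) < s := hs
    have h1 : s / (2 * x) < t / (2 * x) := by gcongr
    have : 0 < s / (2 * x) := by positivity
    exact mul_lt_mul'' hst (by linarith) hs.le (by linarith)
  have himg : Q '' Ioi 0 = Ioi 0 := by
    ext c
    constructor
    · rintro ⟨u, hu, rfl⟩
      have hu : (0 : ℝ) < u := hu
      simp only [hQ, mem_Ioi]
      positivity
    · intro hc
      have hc : (0 : ℝ) < c := hc
      set D := Real.sqrt (x ^ 2 + 2 * c * x) with hD
      have hD2 : D ^ 2 = x ^ 2 + 2 * c * x := Real.sq_sqrt (by positivity)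
      have hxD : x < D := Real.lt_sqrt_of_sq_lt (by have := mul_pos hc hx; linarith)
      refine ⟨D - x, sub_pos.2 hxD, ?_⟩
      simp only [hQ]
      field_simp
      linear_combination hD2
  set g : ℝ → ℝ := fun v => v ^ a * Real.exp (-(v * Real.exp (-t))) with hg
  have habs : ∀ u ∈ Ioi (0 : ℝ), |1 + u / x| • g (Q u) = (1 + u / x) * g (Q u) := by
    intro u hu
    have hu : (0 : ℝ) < u := hu
    rw [smul_eq_mul, abs_of_pos (by positivity)]
  have hgi : IntegrableOn g (Ioi 0) := by
    have := integrableOn_rpow_mul_exp_neg_mul_rpow (s := a) (p := 1) (b := Real.exp (-t)) ha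
      one_pos (Real.exp_pos _)
    refine this.congr_fun (fun v _ => ?_) measurableSet_Ioi
    simp only [hg, Real.rpow_one]
    ring_nf
  constructor
  · have := (integrableOn_image_iff_integrableOn_abs_deriv_smul measurableSet_Ioi hd hinj g).1
      (by rwa [himg])
    exact this.congr_fun habs measurableSet_Ioi
  · have := integral_image_eq_integral_abs_deriv_smul measurableSet_Ioi hd hinj g
    rw [himg, setIntegral_congr_fun measurableSet_Ioi habs] at this
    rw [← this]
    have hG := Real.integral_rpow_mul_exp_neg_mul_Ioi (a := a + 1) (by linarith)
      (Real.exp_pos (-t))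
    rw [one_div, ← Real.exp_neg, neg_neg, ← Real.exp_mul, mul_comm t,
      mul_comm _ (Real.Gamma _)] at hG
    rw [← hG]
    refine setIntegral_congr_fun measurableSet_Ioi fun v _ => ?_
    simp only [hg, add_sub_cancel_right]
    ring_nf

/-- The Laplace integral for `K_ν`. With `q = u (1 + u / (2 x))`, the factor `e^(-u)` is written as
an integral of `e^(-q e^(-t))` over `t`, and Tonelli's theorem allows the `u`-integral, now a
Gamma integral in `q`, to be done first. -/
theorem integral_hankel_eq_besselK {a : ℝ} (ha : -1 < a) {x : ℝ} (hx : 0 < x) :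
    ∫ u in Ioi (0 : ℝ), Real.exp (-u) * (u * (1 + u / (2 * x))) ^ a =
      Real.exp x * Real.sqrt (x / (2 * Real.pi)) * Real.Gamma (a + 1) *
        (2 * besselK (a + 1 / 2) x) := by
  set c : ℝ := Real.exp x * Real.sqrt (x / (2 * Real.pi)) with hc
  have hc0 : 0 < c := by positivity
  have hG := Real.Gamma_pos_of_pos (show 0 < a + 1 by linarith)
  set p : ℝ := Real.sqrt (x / 2) with hp
  have hp0 : 0 < p := by positivity
  have hp2 : p ^ 2 = x / 2 := Real.sq_sqrt (by positivity)
  set F : ℝ → ℝ → ℝ := fun u t => c * ((1 + u / x) * ((u * (1 + u / (2 * x))) ^ a *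
    Real.exp (-(u * (1 + u / (2 * x)) * Real.exp (-t))))) *
    Real.exp (-(x * Real.cosh t) - t / 2) with hF
  have hF0 : ∀ u, 0 < u → ∀ t, 0 ≤ F u t := fun u hu t => by
    simp only [hF]; positivity
  have hFm : Measurable (Function.uncurry F) := by
    simp only [hF, Function.uncurry_def]
    fun_prop
  -- the integral over `t` restores `e^(-u)`
  have ht : ∀ u, 0 < u → ∫⁻ t, ENNReal.ofReal (F u t) =
      ENNReal.ofReal (Real.exp (-u) * (u * (1 + u / (2 * x))) ^ a) := by
    intro u hu
    have hw : 0 < 1 + u / x := by positivity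
    obtain ⟨hi, hv⟩ := integral_exp_neg_exp_sub_half hp0 (mul_pos hp0 hw)
    have hFe : F u = fun t => c * ((1 + u / x) * (u * (1 + u / (2 * x))) ^ a) *
        Real.exp (-(p ^ 2 * Real.exp t) - (p * (1 + u / x)) ^ 2 * Real.exp (-t) - t / 2) := by
      ext t
      have : -(p ^ 2 * Real.exp t) - (p * (1 + u / x)) ^ 2 * Real.exp (-t) - t / 2 =
          -(u * (1 + u / (2 * x)) * Real.exp (-t)) + (-(x * Real.cosh t) - t / 2) := by
        rw [mul_pow, hp2, Real.cosh_eq]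
        field_simp
        ring
      rw [this, Real.exp_add]
      simp only [hF]
      ring
    rw [← ofReal_integral_eq_lintegral_ofReal (by rw [hFe]; exact hi.const_mul _)
      (Eventually.of_forall (hF0 u hu)), hFe, integral_const_mul, hv]
    congr 1
    have h1 : 2 * p * (p * (1 + u / x)) = x + u := by
      rw [show 2 * p * (p * (1 + u / x)) = 2 * p ^ 2 * (1 + u / x) by ring, hp2]
      field_simp
    have h2 : Real.sqrt (x / (2 * Real.pi)) * Real.sqrt Real.pi = p := by
      rw [← Real.sqrt_mul (by positivity), hp]
      congr 1
      field_simp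
    have h3 : Real.exp x * Real.exp (-(x + u)) = Real.exp (-u) := by
      rw [← Real.exp_add]; congr 1; ring
    rw [h1, hc]
    calc Real.exp x * Real.sqrt (x / (2 * Real.pi)) * ((1 + u / x) * (u * (1 + u / (2 * x))) ^ a) *
          (Real.sqrt Real.pi / (p * (1 + u / x)) * Real.exp (-(x + u)))
        = (Real.exp x * Real.exp (-(x + u))) *
          ((Real.sqrt (x / (2 * Real.pi)) * Real.sqrt Real.pi) / p) *
          (((1 + u / x) / (1 + u / x)) * (u * (1 + u / (2 * x))) ^ a) := by
            field_simp
      _ = _ := by rw [h2, h3, div_self hp0.ne', div_self hw.ne']; ring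
  have hu : ∀ t, ∫⁻ u in Ioi (0 : ℝ), ENNReal.ofReal (F u t) =
      ENNReal.ofReal (c * Real.Gamma (a + 1) *
        Real.exp (-(x * Real.cosh t) + (a + 1 / 2) * t)) := by
    intro t
    obtain ⟨hi, hv⟩ := integral_mul_exp_neg_mul_exp ha hx t
    rw [← ofReal_integral_eq_lintegral_ofReal ((hi.const_mul c).mul_const _) ?_]
    · rw [integral_mul_const, integral_const_mul, hv]
      congr 1
      rw [show -(x * Real.cosh t) + (a + 1 / 2) * t =
        (a + 1) * t + (-(x * Real.cosh t) - t / 2) by ring, Real.exp_add]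
      ring
    · filter_upwards [ae_restrict_mem measurableSet_Ioi] with u hu using hF0 u hu t
  have hswap : ∫⁻ u in Ioi (0 : ℝ), ∫⁻ t, ENNReal.ofReal (F u t) =
      ∫⁻ t, ∫⁻ u in Ioi (0 : ℝ), ENNReal.ofReal (F u t) :=
    lintegral_lintegral_swap hFm.ennreal_ofReal.aemeasurable
  rw [setLIntegral_congr_fun measurableSet_Ioi ht] at hswap
  simp only [hu] at hswap
  rw [← integral_exp_neg_mul_cosh_add hx, ← integral_const_mul,
    integral_eq_lintegral_of_nonneg_ae, integral_eq_lintegral_of_nonneg_ae, hswap]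
  · exact Eventually.of_forall fun t => by positivity
  · exact Continuous.aestronglyMeasurable (by fun_prop)
  · filter_upwards [ae_restrict_mem measurableSet_Ioi] with u hu
    have hu : (0 : ℝ) < u := hu
    positivity
  · exact Measurable.aestronglyMeasurable (by fun_prop)

theorem besselK_abs (ν x : ℝ) : besselK |ν| x = besselK ν x := by
  rcases abs_choice ν with h | h <;> simp [h, besselK, Real.cosh_neg]

theorem besselK_eq_hankelIntegral (ν : ℝ) {x : ℝ} (hx : 0 < x) :
    (besselK ν x : ℂ) = ((Real.sqrt (Real.pi / (2 * x)) * Real.exp (-x) /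
      Real.Gamma (|ν| + 1 / 2) : ℝ) : ℂ) * hankelIntegral (|ν| - 1 / 2) (1 / (2 * x) : ℝ) := by
  have h := integral_hankel_eq_besselK (a := |ν| - 1 / 2) (by linarith [abs_nonneg ν]) hx
  rw [sub_add_cancel, besselK_abs, show |ν| - 1 / 2 + 1 = |ν| + 1 / 2 by ring] at h
  have hcast : hankelIntegral (|ν| - 1 / 2) (1 / (2 * x) : ℝ) =
      ((∫ u in Ioi (0 : ℝ), Real.exp (-u) * (u * (1 + u / (2 * x))) ^ (|ν| - 1 / 2) : ℝ) : ℂ) := by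
    rw [hankelIntegral, ← integral_complex_ofReal]
    refine setIntegral_congr_fun measurableSet_Ioi fun u hu => ?_
    have hu : (0 : ℝ) < u := hu
    have e : (1 : ℂ) + u * ((1 / (2 * x) : ℝ) : ℂ) = ((1 + u / (2 * x) : ℝ) : ℂ) := by
      push_cast; ring
    simp only [e]
    rw [← Complex.ofReal_cpow (by positivity), ← Complex.ofReal_mul,
      Real.mul_rpow hu.le (by positivity), mul_assoc]
  have hG := Real.Gamma_pos_of_pos (show 0 < |ν| + 1 / 2 by positivity)
  have hs : Real.sqrt (Real.pi / (2 * x)) * Real.sqrt (x / (2 * Real.pi)) = 1 / 2 := by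
    rw [← Real.sqrt_mul (by positivity),
      show Real.pi / (2 * x) * (x / (2 * Real.pi)) = (1 / 2) ^ 2 by field_simp,
      Real.sqrt_sq (by norm_num)]
  have he : Real.exp (-x) * Real.exp x = 1 := by rw [← Real.exp_add]; simp
  rw [hcast, ← Complex.ofReal_mul, h]
  congr 1
  set G := Real.Gamma (|ν| + 1 / 2)
  calc besselK ν x = (Real.exp (-x) * Real.exp x) * (2 * (Real.sqrt (Real.pi / (2 * x)) *
        Real.sqrt (x / (2 * Real.pi)))) * (G / G) * besselK ν x := by
        rw [div_self hG.ne', hs, he]; ring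
    _ = _ := by ring

/-! ### Hankel's loop integral for `1 / Γ` -/

/-- The part of Hankel's loop integral for `1 / Γ(1 - a)` along the cut, on which `t = -r e^u`. -/
noncomputable def hankelRay (r a : ℝ) : ℝ :=
  ∫ u in Ioi (0 : ℝ), Real.exp (-(r * Real.exp u) + a * u)

/-- The part of Hankel's loop integral for `1 / Γ(1 - a)` on the circle of radius `r`, the lower
half of which contributes the complex conjugate of the upper half. -/
noncomputable def hankelArc (r a : ℝ) : ℝ :=
  ∫ θ in (0 : ℝ)..Real.pi, (Complex.exp (r * Complex.exp (θ * Complex.I) + a * θ * Complex.I)).re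

/-- Integration by parts. -/
theorem hankelRay_add_one {r : ℝ} (hr : 0 < r) (a : ℝ) :
    a * hankelRay r a = r * hankelRay r (a + 1) - Real.exp (-r) := by
  have hd : ∀ u ∈ Ici (0 : ℝ), HasDerivAt (fun u : ℝ => Real.exp (-(r * Real.exp u) + a * u))
      (a * Real.exp (-(r * Real.exp u) + a * u) -
        r * Real.exp (-(r * Real.exp u) + (a + 1) * u)) u := by
    intro u _
    have h := (((Real.hasDerivAt_exp u).const_mul r).fun_neg.add
      ((hasDerivAt_id u).const_mul a)).exp
    refine h.congr_deriv ?_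
    have e : -(r * Real.exp u) + (a + 1) * u = (-(r * Real.exp u) + a * u) + u := by ring
    rw [e, Real.exp_add _ u]
    simp
    ring
  have hi := ((integrableOn_exp_neg_mul_exp_add hr a).const_mul a).sub
    ((integrableOn_exp_neg_mul_exp_add hr (a + 1)).const_mul r)
  have hlim : Tendsto (fun u : ℝ => Real.exp (-(r * Real.exp u) + a * u)) atTop (𝓝 0) := by
    obtain ⟨C, hC⟩ := exists_exp_neg_mul_exp_add_le hr a
    have h0 : Tendsto (fun u : ℝ => C * Real.exp (-u)) atTop (𝓝 0) := by
      simpa using (Real.tendsto_exp_neg_atTop_nhds_zero).const_mul C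
    refine tendsto_of_tendsto_of_tendsto_of_le_of_le' tendsto_const_nhds h0
      (Eventually.of_forall fun u => (Real.exp_pos _).le) ?_
    filter_upwards [eventually_ge_atTop 0] with u hu using hC u hu
  have h := integral_Ioi_of_hasDerivAt_of_tendsto' hd hi hlim
  rw [integral_sub ((integrableOn_exp_neg_mul_exp_add hr a).const_mul a)
    ((integrableOn_exp_neg_mul_exp_add hr (a + 1)).const_mul r), integral_const_mul,
    integral_const_mul] at h
  simp only [Real.exp_zero, mul_one, mul_zero, add_zero] at h
  simp only [hankelRay]
  linarith

theorem real_hasSum_exp (x : ℝ) : HasSum (fun n : ℕ => x ^ n / n.factorial) (Real.exp x) := by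
  rw [Real.exp_eq_exp_ℝ]
  exact NormedSpace.expSeries_div_hasSum_exp x

theorem complex_hasSum_exp (z : ℂ) :
    HasSum (fun n : ℕ => z ^ n / n.factorial) (Complex.exp z) := by
  rw [Complex.exp_eq_exp_ℂ]
  exact NormedSpace.expSeries_div_hasSum_exp z

/-- Euler's integral for `Γ(a)` with `t = r e^u` on the whole line. -/
theorem Gamma_eq_integral_exp {r a : ℝ} (hr : 0 < r) (ha : 0 < a) :
    IntegrableOn (fun u : ℝ => Real.exp (-(r * Real.exp u) + a * u)) (Iic 0) ∧
    Real.Gamma a = r ^ a * ((∫ u in Iic (0 : ℝ), Real.exp (-(r * Real.exp u) + a * u)) +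
      hankelRay r a) := by
  have hd : ∀ u ∈ (univ : Set ℝ),
      HasDerivWithinAt (fun u => r * Real.exp u) (r * Real.exp u) univ u :=
    fun u _ => ((Real.hasDerivAt_exp u).const_mul r).hasDerivWithinAt
  have hinj : InjOn (fun u => r * Real.exp u) univ := fun s _ t _ h =>
    Real.exp_injective (mul_left_cancel₀ hr.ne' h)
  have himg : (fun u => r * Real.exp u) '' univ = Ioi 0 := by
    ext c
    constructor
    · rintro ⟨u, -, rfl⟩
      exact mul_pos hr (Real.exp_pos u)
    · intro hc
      refine ⟨Real.log (c / r), mem_univ _, ?_⟩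
      simp only [Real.exp_log (div_pos hc hr)]
      field_simp
  set g : ℝ → ℝ := fun t => Real.exp (-t) * t ^ (a - 1) with hg
  have hfun : (fun u => |r * Real.exp u| • g (r * Real.exp u)) =
      fun u => r ^ a * Real.exp (-(r * Real.exp u) + a * u) := by
    ext u
    rw [smul_eq_mul, abs_of_pos (by positivity)]
    simp only [hg]
    rw [Real.rpow_sub_one (by positivity), Real.mul_rpow hr.le (Real.exp_pos u).le,
      ← Real.exp_mul, Real.exp_add, mul_comm u a]
    field_simp
  have hgi : IntegrableOn g (Ioi 0) := Real.GammaIntegral_convergent ha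
  have hi := (integrableOn_image_iff_integrableOn_abs_deriv_smul MeasurableSet.univ hd hinj g).1
    (by rwa [himg])
  have hv := integral_image_eq_integral_abs_deriv_smul MeasurableSet.univ hd hinj g
  rw [hfun] at hi
  simp only [hfun] at hv
  have hra : r ^ a ≠ 0 := (Real.rpow_pos_of_pos hr a).ne'
  have hi' : Integrable (fun u => Real.exp (-(r * Real.exp u) + a * u)) := by
    rw [integrableOn_univ] at hi
    refine (hi.const_mul (r ^ a)⁻¹).congr (Eventually.of_forall fun u => ?_)
    simp only
    rw [inv_mul_cancel_left₀ hra]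
  refine ⟨hi'.integrableOn, ?_⟩
  rw [himg, ← Real.Gamma_eq_integral ha] at hv
  rw [hv, setIntegral_univ, integral_const_mul, hankelRay,
    intervalIntegral.integral_Iic_add_Ioi hi'.integrableOn hi'.integrableOn]

/-- The lower incomplete Gamma function, multiplied by `r^(-a)`, as the integral over `u < 0` of
`e^(-r e^u + a u)`; the exponential series is integrated termwise. -/
theorem hasSum_lowerGamma_of_pos {r a : ℝ} (hr : 0 < r) (ha : 0 < a) :
    HasSum (fun j : ℕ => (-r) ^ j / (j.factorial * (j + a)))
      (Real.Gamma a * r ^ (-a) - hankelRay r a) := by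
  obtain ⟨hi, hG⟩ := Gamma_eq_integral_exp hr ha
  have hja : ∀ j : ℕ, 0 < (j : ℝ) + a := fun j => by positivity
  have hexp : ∀ b : ℝ, 0 < b → IntegrableOn (fun u : ℝ => Real.exp (-b * u)) (Ioi 0) ∧
      ∫ u in Ioi (0 : ℝ), Real.exp (-b * u) = 1 / b := by
    intro b hb
    refine ⟨exp_neg_integrableOn_Ioi 0 hb, ?_⟩
    rw [integral_exp_mul_Ioi (by linarith)]
    simp
  set F : ℕ → ℝ → ℝ := fun j u => (-r) ^ j / j.factorial * Real.exp (-(j + a) * u) with hF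
  have hFi : ∀ j, IntegrableOn (F j) (Ioi 0) := fun j => (hexp _ (hja j)).1.const_mul _
  have hs : HasSum (fun j => ∫ u in Ioi (0 : ℝ), F j u) (∫ u in Ioi (0 : ℝ), ∑' j, F j u) := by
    refine hasSum_integral_of_summable_integral_norm hFi ?_
    have hn : ∀ j, ∫ u in Ioi (0 : ℝ), ‖F j u‖ = r ^ j / j.factorial * (1 / (j + a)) := by
      intro j
      rw [← (hexp _ (hja j)).2, ← integral_const_mul]
      refine setIntegral_congr_fun measurableSet_Ioi fun u _ => ?_
      simp only [hF]
      rw [norm_mul, norm_div, norm_pow, norm_neg, Real.norm_of_nonneg hr.le,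
        Real.norm_of_nonneg (Real.exp_pos _).le, Real.norm_of_nonneg (Nat.cast_nonneg _)]
    simp only [hn]
    refine Summable.of_nonneg_of_le (fun j => ?_) (fun j => ?_)
      ((real_hasSum_exp r).summable.mul_right (1 / a))
    · have := hja j
      positivity
    · have : a ≤ j + a := by linarith [(Nat.cast_nonneg j : (0 : ℝ) ≤ j)]
      gcongr
  have hsum : ∀ u : ℝ, ∑' j, F j u = Real.exp (-(r * Real.exp (-u)) + a * -u) := by
    intro u
    have h := (real_hasSum_exp (-(r * Real.exp (-u)))).mul_right (Real.exp (a * -u))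
    rw [← Real.exp_add] at h
    rw [← h.tsum_eq]
    refine tsum_congr fun j => ?_
    have : Real.exp (-(j + a) * u) = Real.exp (-u) ^ j * Real.exp (a * -u) := by
      rw [← Real.exp_nat_mul, ← Real.exp_add]; congr 1; ring
    simp only [hF]
    rw [this, neg_mul_eq_neg_mul, mul_pow]
    ring
  simp only [hsum] at hs
  rw [integral_comp_neg_Ioi 0 (fun v => Real.exp (-(r * Real.exp v) + a * v)), neg_zero] at hs
  have hval : (∫ u in Iic (0 : ℝ), Real.exp (-(r * Real.exp u) + a * u)) =
      Real.Gamma a * r ^ (-a) - hankelRay r a := by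
    rw [hG, Real.rpow_neg hr.le]
    have := (Real.rpow_pos_of_pos hr a).ne'
    field_simp
    ring
  rw [hval] at hs
  convert! hs using 2 with j
  simp only [hF]
  rw [integral_const_mul, (hexp _ (hja j)).2, div_mul_div_comm, mul_one]

/-- The series for the lower incomplete Gamma function, for all `a` for which `Γ(a)` is defined;
integration by parts leads from `a + 1` to `a`. -/
theorem hasSum_lowerGamma {r : ℝ} (hr : 0 < r) {a : ℝ} (ha : ∀ j : ℕ, a ≠ -j) :
    HasSum (fun j : ℕ => (-r) ^ j / (j.factorial * (j + a)))
      (Real.Gamma a * r ^ (-a) - hankelRay r a) := by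
  obtain ⟨n, hn⟩ := exists_nat_gt (-a)
  induction n generalizing a with
  | zero => exact hasSum_lowerGamma_of_pos hr (by simpa using hn)
  | succ n ih =>
    have ha0 : a ≠ 0 := by simpa using ha 0
    have hja : ∀ j : ℕ, (j : ℝ) + a ≠ 0 := fun j h => ha j (by linarith)
    have h := ih (a := a + 1)
      (fun j h => ha (j + 1) (by push_cast; linarith)) (by push_cast at hn; linarith)
    set s : ℕ → ℝ := fun j => j * (-r) ^ j / (j.factorial * (j + a)) with hs
    have h1 : HasSum (fun j => s (j + 1))
        (-r * (Real.Gamma (a + 1) * r ^ (-(a + 1)) - hankelRay r (a + 1))) := by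
      convert! h.mul_left (-r) using 2 with j
      simp only [hs, Nat.factorial_succ]
      have := hja (j + 1)
      push_cast at this ⊢
      have h' : (j : ℝ) + (a + 1) ≠ 0 := by rwa [add_comm a, ← add_assoc]
      have hf : ((j.factorial : ℕ) : ℝ) ≠ 0 := by positivity
      have hj : (j : ℝ) + 1 ≠ 0 := by positivity
      field_simp
      ring
    have h2 := (hasSum_nat_add_iff 1).1 h1
    have h3 := ((real_hasSum_exp (-r)).sub h2).div_const a
    convert! h3 using 1
    · ext j
      have := hja j
      have hf : ((j.factorial : ℕ) : ℝ) ≠ 0 := by positivity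
      simp only [hs]
      field_simp
      ring
    · have hrec := hankelRay_add_one hr a
      have hr1 : r ^ (-(a + 1)) = r ^ (-a) / r := by
        rw [neg_add, ← sub_eq_add_neg, Real.rpow_sub_one hr.ne']
      rw [Real.Gamma_add_one ha0, hr1]
      simp only [hs, Finset.range_one, Finset.sum_singleton, Nat.cast_zero, zero_mul, zero_div,
        add_zero]
      field_simp
      linear_combination -hrec

theorem integral_cos_mul (c : ℝ) :
    ∫ θ in (0 : ℝ)..Real.pi, Real.cos (c * θ) =
      if c = 0 then Real.pi else Real.sin (c * Real.pi) / c := by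
  split_ifs with h
  · simp [h]
  · rw [intervalIntegral.integral_comp_mul_left _ h]
    simp
    ring

/-- The circle contributes a series with the same denominators `j + a` as the lower incomplete Gamma
function, which is why the two combine in `inv_Gamma_one_sub`. -/
theorem hasSum_hankelArc {r : ℝ} (hr : 0 < r) (a : ℝ) :
    HasSum (fun j : ℕ => r ^ j / j.factorial * ∫ θ in (0 : ℝ)..Real.pi, Real.cos ((j + a) * θ))
      (hankelArc r a) := by
  have hcongr : ∀ j : ℕ, r ^ j / j.factorial * ∫ θ in (0 : ℝ)..Real.pi, Real.cos ((j + a) * θ) =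
      ∫ θ in (0 : ℝ)..Real.pi, r ^ j / j.factorial * Real.cos ((j + a) * θ) :=
    fun j => (intervalIntegral.integral_const_mul _ _).symm
  simp only [hcongr]
  refine intervalIntegral.hasSum_integral_of_dominated_convergence
    (fun j _ => r ^ j / j.factorial) (fun j => Continuous.aestronglyMeasurable (by fun_prop))
    (fun j => Eventually.of_forall fun θ _ => ?_)
    (Eventually.of_forall fun θ _ => (real_hasSum_exp r).summable) ?_
    (Eventually.of_forall fun θ _ => ?_)
  · rw [norm_mul, Real.norm_of_nonneg (by positivity)]
    exact mul_le_of_le_one_right (by positivity) (Real.abs_cos_le_one _)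
  · exact intervalIntegrable_const
  · have h := (complex_hasSum_exp (r * Complex.exp (θ * Complex.I))).mul_right
      (Complex.exp (a * θ * Complex.I))
    rw [← Complex.exp_add] at h
    have h' := Complex.hasSum_re h
    convert! h' using 2 with j
    have : (r * Complex.exp (θ * Complex.I)) ^ j / (j.factorial : ℂ) *
        Complex.exp (a * θ * Complex.I) =
        ((r ^ j / j.factorial : ℝ) : ℂ) * Complex.exp (((j + a) * θ : ℝ) * Complex.I) := by
      rw [mul_pow, ← Complex.exp_nat_mul, mul_div_right_comm, mul_assoc, ← Complex.exp_add]
      push_cast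
      congr 2
      ring
    rw [this, Complex.re_ofReal_mul, Complex.exp_ofReal_mul_I_re]

/-- Hankel's loop integral for the reciprocal of the Gamma function, in real form. With Mathlib's
value `0` of `Γ` at its poles it holds for all real `a`. -/
theorem inv_Gamma_one_sub {r : ℝ} (hr : 0 < r) (a : ℝ) :
    (Real.Gamma (1 - a))⁻¹ = r ^ a / Real.pi *
      (hankelArc r a + Real.sin (Real.pi * a) * hankelRay r a) := by
  have hπ := Real.pi_pos
  by_cases ha : ∃ n : ℕ, a = -n
  · obtain ⟨n, rfl⟩ := ha
    have hsin : Real.sin (Real.pi * -n) = 0 := by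
      rw [mul_neg, Real.sin_neg, mul_comm, Real.sin_nat_mul_pi, neg_zero]
    have hA : hankelArc r (-n) = r ^ n / n.factorial * Real.pi := by
      refine (hasSum_hankelArc hr (-n)).unique ?_
      have : r ^ n / n.factorial * Real.pi =
          r ^ n / n.factorial * ∫ θ in (0 : ℝ)..Real.pi, Real.cos ((n + -n) * θ) := by simp
      rw [this]
      refine hasSum_single n fun j hj => ?_
      have hne : (j : ℝ) + -n ≠ 0 := fun h => hj (by
        have : (j : ℝ) = n := by linarith
        exact_mod_cast this)
      have hs : Real.sin (((j : ℝ) + -n) * Real.pi) = 0 := by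
        have := Real.sin_int_mul_pi (j - n)
        push_cast at this
        rwa [sub_eq_add_neg] at this
      rw [integral_cos_mul, if_neg hne, hs]
      simp
    rw [hsin, zero_mul, add_zero, hA, sub_neg_eq_add, add_comm, Real.Gamma_nat_eq_factorial,
      Real.rpow_neg hr.le, Real.rpow_natCast]
    have : r ^ n ≠ 0 := by positivity
    field_simp
  · push Not at ha
    have hja : ∀ j : ℕ, (j : ℝ) + a ≠ 0 := fun j h => ha j (by linarith)
    have hA : hankelArc r a = Real.sin (Real.pi * a) *
        (Real.Gamma a * r ^ (-a) - hankelRay r a) := by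
      refine (hasSum_hankelArc hr a).unique ?_
      convert! (hasSum_lowerGamma hr ha).mul_left (Real.sin (Real.pi * a)) using 2 with j
      rw [integral_cos_mul, if_neg (hja j), add_mul, add_comm, mul_comm a,
        Real.sin_add_nat_mul_pi, neg_pow r]
      have := hja j
      field_simp
    rw [hA]
    have hrefl := Real.Gamma_mul_Gamma_one_sub a
    have hG : Real.Gamma a ≠ 0 := Real.Gamma_ne_zero ha
    have hr0 := (Real.rpow_pos_of_pos hr a).ne'
    have e : (Real.Gamma (1 - a))⁻¹ = Real.Gamma a * Real.sin (Real.pi * a) / Real.pi := by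
      rw [eq_div_of_mul_eq hG ((mul_comm _ _).trans hrefl)]
      simp only [inv_div]
      field_simp
    rw [e, Real.rpow_neg hr.le]
    field_simp
    ring

/-! ### Schläfli's integrals for `J_ν` and `Y_ν` -/

/-- Schläfli's integral for the power series of `I_ν(2 r)` (`ε = 1`) and of `J_ν(2 r)` (`ε = -1`):
Hankel's loop integral, with the radius `r`, is inserted for each `1 / Γ(ν + k + 1)` and the sum
over `k` is carried out under the integrals. -/
theorem hasSum_schlafli {r : ℝ} (hr : 0 < r) {ε : ℝ} (hε : |ε| = 1) (ν : ℝ) :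
    HasSum (fun k : ℕ => ε ^ k / (k.factorial * Real.Gamma (ν + k + 1)) * r ^ (ν + 2 * k))
      (((∫ θ in (0 : ℝ)..Real.pi, (Complex.exp (r * Complex.exp (θ * Complex.I) +
          ε * r * Complex.exp (-(θ * Complex.I)) - ν * θ * Complex.I)).re) -
        Real.sin (Real.pi * ν) * ∫ u in Ioi (0 : ℝ),
          Real.exp (-(r * Real.exp u) - ε * r * Real.exp (-u) - ν * u)) / Real.pi) := by
  have hsummable : Summable fun k : ℕ => r ^ k / k.factorial := (real_hasSum_exp r).summable
  have hterm : ∀ k : ℕ, ε ^ k / (k.factorial * Real.Gamma (ν + k + 1)) * r ^ (ν + 2 * k) =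
      ((ε * r) ^ k / k.factorial * hankelArc r (-(ν + k)) - Real.sin (Real.pi * ν) *
        ((-(ε * r)) ^ k / k.factorial * hankelRay r (-(ν + k)))) / Real.pi := by
    intro k
    have h := inv_Gamma_one_sub hr (-(ν + k))
    rw [show 1 - -(ν + (k : ℝ)) = ν + k + 1 by ring] at h
    have hs : Real.sin (Real.pi * -(ν + k)) = -((-1) ^ k * Real.sin (Real.pi * ν)) := by
      rw [mul_neg, Real.sin_neg, mul_add, mul_comm Real.pi (k : ℝ), Real.sin_add_nat_mul_pi]
    have hp : r ^ (-(ν + k)) * r ^ (ν + 2 * k) = r ^ k := by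
      rw [← Real.rpow_add hr, ← Real.rpow_natCast]; congr 1; ring
    rw [div_mul_eq_div_mul_one_div, one_div, h, hs, neg_pow (ε * r), mul_pow, ← hp]
    ring
  have hA : HasSum (fun k : ℕ => (ε * r) ^ k / k.factorial * hankelArc r (-(ν + k)))
      (∫ θ in (0 : ℝ)..Real.pi, (Complex.exp (r * Complex.exp (θ * Complex.I) +
        ε * r * Complex.exp (-(θ * Complex.I)) - ν * θ * Complex.I)).re) := by
    have hcongr : ∀ k : ℕ, (ε * r) ^ k / k.factorial * hankelArc r (-(ν + k)) =
        ∫ θ in (0 : ℝ)..Real.pi, (ε * r) ^ k / k.factorial *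
          (Complex.exp (r * Complex.exp (θ * Complex.I) +
            (-(ν + k) : ℝ) * θ * Complex.I)).re :=
      fun k => (intervalIntegral.integral_const_mul _ _).symm
    simp only [hcongr]
    refine intervalIntegral.hasSum_integral_of_dominated_convergence
      (fun k _ => r ^ k / k.factorial * Real.exp r)
      (fun k => Continuous.aestronglyMeasurable (by fun_prop))
      (fun k => Eventually.of_forall fun θ _ => ?_)
      (Eventually.of_forall fun θ _ => hsummable.mul_right _) intervalIntegrable_const
      (Eventually.of_forall fun θ _ => ?_)
    · have hre : (r * Complex.exp (θ * Complex.I) +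
          (-(ν + k) : ℝ) * θ * Complex.I : ℂ).re ≤ r := by
        have h1 : ((-(ν + k) : ℝ) * θ * Complex.I : ℂ).re = 0 := by simp
        rw [Complex.add_re, h1, Complex.re_ofReal_mul, Complex.exp_ofReal_mul_I_re, add_zero]
        exact mul_le_of_le_one_right hr.le (Real.cos_le_one θ)
      have hn : ‖(ε * r) ^ k / (k.factorial : ℝ)‖ = r ^ k / k.factorial := by
        rw [norm_div, norm_pow, norm_mul, Real.norm_eq_abs ε, hε, one_mul,
          Real.norm_of_nonneg hr.le, Real.norm_of_nonneg (Nat.cast_nonneg _)]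
      rw [norm_mul, hn]
      gcongr
      refine (Complex.abs_re_le_norm _).trans ?_
      rw [Complex.norm_exp]
      exact Real.exp_le_exp.2 hre
    · have h := (complex_hasSum_exp (ε * r * Complex.exp (-(θ * Complex.I)))).mul_right
        (Complex.exp (r * Complex.exp (θ * Complex.I) - ν * θ * Complex.I))
      rw [← Complex.exp_add] at h
      convert! Complex.hasSum_re h using 2 with k
      · rw [← Complex.re_ofReal_mul]
        congr 1
        rw [mul_pow ((ε : ℂ) * r), ← Complex.exp_nat_mul, mul_div_right_comm,
          mul_assoc (((ε : ℂ) * r) ^ k / (k.factorial : ℂ)), ← Complex.exp_add]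
        push_cast
        congr 2
        ring
      · congr 1
        ring
  have hR : HasSum (fun k : ℕ => (-(ε * r)) ^ k / k.factorial * hankelRay r (-(ν + k)))
      (∫ u in Ioi (0 : ℝ), Real.exp (-(r * Real.exp u) - ε * r * Real.exp (-u) - ν * u)) := by
    have hi : ∀ a : ℝ, IntegrableOn (fun u : ℝ => Real.exp (-(r * Real.exp u) + a * u)) (Ioi 0) :=
      fun a => integrableOn_exp_neg_mul_exp_add hr a
    set F : ℕ → ℝ → ℝ := fun k u => (-(ε * r)) ^ k / k.factorial *
      Real.exp (-(r * Real.exp u) + -(ν + k) * u) with hF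
    have hcongr : ∀ k : ℕ, (-(ε * r)) ^ k / k.factorial * hankelRay r (-(ν + k)) =
        ∫ u in Ioi (0 : ℝ), F k u := fun k => (integral_const_mul _ _).symm
    simp only [hcongr]
    have hs : HasSum (fun k => ∫ u in Ioi (0 : ℝ), F k u) (∫ u in Ioi (0 : ℝ), ∑' k, F k u) := by
      refine hasSum_integral_of_summable_integral_norm (fun k => (hi _).const_mul _) ?_
      have hn : ∀ k, ∫ u in Ioi (0 : ℝ), ‖F k u‖ =
          r ^ k / k.factorial * hankelRay r (-(ν + k)) := by
        intro k
        rw [hankelRay, ← integral_const_mul]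
        refine setIntegral_congr_fun measurableSet_Ioi fun u _ => ?_
        simp only [hF]
        rw [norm_mul, norm_div, norm_pow, norm_neg, norm_mul, Real.norm_eq_abs ε, hε, one_mul,
          Real.norm_of_nonneg hr.le, Real.norm_of_nonneg (Real.exp_pos _).le,
          Real.norm_of_nonneg (Nat.cast_nonneg _)]
      simp only [hn]
      have hnn : ∀ k : ℕ, 0 ≤ hankelRay r (-(ν + k)) := fun k =>
        integral_nonneg fun u => (Real.exp_pos _).le
      refine Summable.of_nonneg_of_le (fun k => mul_nonneg (by positivity) (hnn k)) (fun k => ?_)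
        (hsummable.mul_right (hankelRay r (-ν)))
      refine mul_le_mul_of_nonneg_left ?_ (by positivity)
      refine setIntegral_mono_on (hi _) (hi _) measurableSet_Ioi fun u hu => ?_
      rw [Real.exp_le_exp]
      have : 0 ≤ (k : ℝ) * u := mul_nonneg (Nat.cast_nonneg k) (le_of_lt hu)
      linarith
    have hsum : ∀ u : ℝ, ∑' k, F k u =
        Real.exp (-(r * Real.exp u) - ε * r * Real.exp (-u) - ν * u) := by
      intro u
      have h := (real_hasSum_exp (-(ε * r * Real.exp (-u)))).mul_right
        (Real.exp (-(r * Real.exp u) - ν * u))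
      rw [← Real.exp_add] at h
      rw [show -(r * Real.exp u) - ε * r * Real.exp (-u) - ν * u =
        -(ε * r * Real.exp (-u)) + (-(r * Real.exp u) - ν * u) by ring, ← h.tsum_eq]
      refine tsum_congr fun k => ?_
      have : Real.exp (-(r * Real.exp u) + -(ν + k) * u) =
          Real.exp (-u) ^ k * Real.exp (-(r * Real.exp u) - ν * u) := by
        rw [← Real.exp_nat_mul, ← Real.exp_add]; congr 1; ring
      simp only [hF]
      rw [this, neg_mul_eq_neg_mul, mul_pow]
      ring
    simpa only [hsum] using hs
  simp only [hterm]
  exact (hA.sub (hR.mul_left _)).div_const _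

/-- The ray integral `∫₀^∞ e^(-x sinh t + a t) dt` in Schläfli's formulas for `J_ν` and `Y_ν`. -/
noncomputable def schlafliRay (a x : ℝ) : ℝ :=
  ∫ t in Ioi (0 : ℝ), Real.exp (-(x * Real.sinh t) + a * t)

/-- The integral `∫₀^π e^(i (x sin θ - ν θ)) dθ` in Schläfli's formulas for `J_ν` and `Y_ν`. -/
noncomputable def schlafliArc (ν x : ℝ) : ℂ :=
  ∫ θ in (0 : ℝ)..Real.pi, Complex.exp (((x * Real.sin θ - ν * θ : ℝ) : ℂ) * Complex.I)

/-- The Hankel function `J_ν + i Y_ν` by Schläfli's integrals, which are entire in `ν`. -/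
noncomputable def schlafliHankel (ν x : ℝ) : ℂ :=
  (schlafliArc ν x - Complex.I * (schlafliRay ν x +
    Complex.exp (-(Real.pi * ν * Complex.I)) * schlafliRay (-ν) x)) / Real.pi

theorem besselJ_eq_schlafli (ν : ℝ) {x : ℝ} (hx : 0 < x) :
    besselJ ν x = ((schlafliArc ν x).re - Real.sin (Real.pi * ν) * schlafliRay (-ν) x) /
      Real.pi := by
  have h := (hasSum_schlafli (half_pos hx) (ε := -1) (by simp) ν).tsum_eq
  rw [besselJ, h, schlafliArc, schlafliRay]
  have hci : IntervalIntegrable (fun θ : ℝ =>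
      Complex.exp (((x * Real.sin θ - ν * θ : ℝ) : ℂ) * Complex.I)) volume 0 Real.pi :=
    Continuous.intervalIntegrable (by fun_prop) _ _
  have hre := Complex.reCLM.intervalIntegral_comp_comm hci
  simp only [Complex.reCLM_apply] at hre
  rw [← hre]
  congr 2
  · refine intervalIntegral.integral_congr fun θ _ => ?_
    congr 2
    have h1 : Complex.exp (θ * Complex.I) = Complex.cos θ + Complex.sin θ * Complex.I :=
      Complex.exp_mul_I _
    have h2 : Complex.exp (-(θ * Complex.I)) = Complex.cos θ - Complex.sin θ * Complex.I := by
      rw [← neg_mul, Complex.exp_mul_I, Complex.cos_neg, Complex.sin_neg]; ring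
    rw [h1, h2]
    push_cast
    ring
  · congr 1
    refine setIntegral_congr_fun measurableSet_Ioi fun u _ => ?_
    congr 1
    rw [Real.sinh_eq]
    ring

theorem re_schlafliHankel (ν : ℝ) {x : ℝ} (hx : 0 < x) :
    (schlafliHankel ν x).re = besselJ ν x := by
  rw [besselJ_eq_schlafli ν hx, schlafliHankel, Complex.div_ofReal_re]
  congr 1
  have : Complex.exp (-(Real.pi * ν * Complex.I)) =
      (Real.cos (Real.pi * ν) : ℂ) - (Real.sin (Real.pi * ν) : ℂ) * Complex.I := by
    rw [← neg_mul, Complex.exp_mul_I, Complex.cos_neg, Complex.sin_neg]; push_cast; ring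
  rw [this]
  generalize Real.cos (Real.pi * ν) = c
  generalize Real.sin (Real.pi * ν) = s
  simp

/-- The reflection `θ ↦ π - θ`. -/
theorem schlafliArc_neg (ν x : ℝ) :
    schlafliArc (-ν) x = Complex.exp (Real.pi * ν * Complex.I) * schlafliArc ν x := by
  have h := intervalIntegral.integral_comp_sub_left (a := 0) (b := Real.pi)
    (fun θ : ℝ => Complex.exp (((x * Real.sin θ - -ν * θ : ℝ) : ℂ) * Complex.I)) Real.pi
  rw [sub_self, sub_zero] at h
  rw [schlafliArc, ← h, schlafliArc, ← intervalIntegral.integral_const_mul]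
  refine intervalIntegral.integral_congr fun θ _ => ?_
  rw [Real.sin_pi_sub, ← Complex.exp_add]
  congr 1
  push_cast
  ring

theorem continuous_schlafliArc (x : ℝ) : Continuous fun ν => schlafliArc ν x :=
  intervalIntegral.continuous_parametric_intervalIntegral_of_continuous' (by fun_prop) _ _

theorem continuous_schlafliRay {x : ℝ} (hx : 0 < x) : Continuous fun a => schlafliRay a x := by
  refine continuous_iff_continuousAt.2 fun a₀ => ?_
  refine continuousAt_of_dominated (bound := fun t => Real.exp (-(x * Real.sinh t) + (a₀ + 1) * t))
    (Eventually.of_forall fun a => Continuous.aestronglyMeasurable (by fun_prop)) ?_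
    (integrableOn_exp_neg_mul_sinh_add hx _)
    (Eventually.of_forall fun t => Continuous.continuousAt (by fun_prop))
  filter_upwards [Iio_mem_nhds (show a₀ < a₀ + 1 by linarith)] with a ha
  filter_upwards [ae_restrict_mem measurableSet_Ioi] with t ht
  rw [Real.norm_of_nonneg (Real.exp_pos _).le, Real.exp_le_exp]
  have := mul_le_mul_of_nonneg_right (le_of_lt ha) (le_of_lt (show (0 : ℝ) < t from ht))
  linarith

theorem continuous_schlafliHankel {x : ℝ} (hx : 0 < x) :
    Continuous fun ν => schlafliHankel ν x := by
  have h1 := continuous_schlafliArc x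
  have h2 := Complex.continuous_ofReal.comp (continuous_schlafliRay hx)
  have h3 := h2.comp continuous_neg
  simp only [Function.comp_def] at h2 h3
  unfold schlafliHankel
  fun_prop

theorem eventually_sin_pi_mul_ne_zero (ν : ℝ) : ∀ᶠ μ in 𝓝[≠] ν, Real.sin (Real.pi * μ) ≠ 0 := by
  by_cases h : Real.sin (Real.pi * ν) = 0
  · have hd : HasDerivAt (fun μ => Real.sin (Real.pi * μ))
        (Real.cos (Real.pi * ν) * Real.pi) ν := by
      simpa using ((hasDerivAt_id ν).const_mul Real.pi).sin
    have hc : Real.cos (Real.pi * ν) ≠ 0 := fun hc => by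
      have := Real.sin_sq_add_cos_sq (Real.pi * ν)
      rw [h, hc] at this
      norm_num at this
    exact hd.eventually_ne (mul_ne_zero hc Real.pi_ne_zero)
  · exact nhdsWithin_le_nhds
      ((show Continuous fun μ => Real.sin (Real.pi * μ) by fun_prop).continuousAt.eventually_ne h)

theorem im_schlafliHankel_of_sin_ne_zero {ν : ℝ} (hν : Real.sin (Real.pi * ν) ≠ 0) {x : ℝ}
    (hx : 0 < x) : (schlafliHankel ν x).im =
      (besselJ ν x * Real.cos (Real.pi * ν) - besselJ (-ν) x) / Real.sin (Real.pi * ν) := by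
  have hπ := Real.pi_ne_zero
  rw [besselJ_eq_schlafli ν hx, besselJ_eq_schlafli (-ν) hx, schlafliArc_neg, schlafliHankel,
    Complex.div_ofReal_im, neg_neg, mul_neg, Real.sin_neg]
  have h1 : Complex.exp (-(Real.pi * ν * Complex.I)) =
      (Real.cos (Real.pi * ν) : ℂ) - (Real.sin (Real.pi * ν) : ℂ) * Complex.I := by
    rw [← neg_mul, Complex.exp_mul_I, Complex.cos_neg, Complex.sin_neg]; push_cast; ring
  have h2 : Complex.exp (Real.pi * ν * Complex.I) =
      (Real.cos (Real.pi * ν) : ℂ) + (Real.sin (Real.pi * ν) : ℂ) * Complex.I := by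
    rw [Complex.exp_mul_I]; push_cast; ring
  rw [h1, h2]
  generalize Real.cos (Real.pi * ν) = c
  generalize Real.sin (Real.pi * ν) = s at hν ⊢
  simp only [Complex.sub_im, Complex.mul_im, Complex.I_re, Complex.I_im, Complex.add_re,
    Complex.add_im, Complex.ofReal_re, Complex.ofReal_im, Complex.mul_re, Complex.sub_re]
  field_simp
  ring

/-- The limit in the definition of `Y_ν` is evaluated by the continuity of Schläfli's integrals
in `ν`. -/
theorem im_schlafliHankel (ν : ℝ) {x : ℝ} (hx : 0 < x) :
    (schlafliHankel ν x).im = besselY ν x := by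
  refine (Tendsto.limUnder_eq ?_).symm
  have h : Tendsto (fun μ => (schlafliHankel μ x).im) (𝓝[≠] ν) (𝓝 (schlafliHankel ν x).im) :=
    ((Complex.continuous_im.comp (continuous_schlafliHankel hx)).tendsto ν).mono_left
      nhdsWithin_le_nhds
  refine h.congr' ?_
  filter_upwards [eventually_sin_pi_mul_ne_zero ν] with μ hμ
  exact im_schlafliHankel_of_sin_ne_zero hμ hx

theorem hasDerivAt_schlafliRay (a : ℝ) {x : ℝ} (hx : 0 < x) :
    HasDerivAt (schlafliRay a) ((schlafliRay (a - 1) x - schlafliRay (a + 1) x) / 2) x := by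
  have hprod : ∀ y t : ℝ, Real.exp (-(y * Real.sinh t) + a * t) * Real.sinh t =
      (Real.exp (-(y * Real.sinh t) + (a + 1) * t) -
        Real.exp (-(y * Real.sinh t) + (a - 1) * t)) / 2 := by
    intro y t
    rw [show -(y * Real.sinh t) + (a + 1) * t = -(y * Real.sinh t) + a * t + t by ring,
      show -(y * Real.sinh t) + (a - 1) * t = -(y * Real.sinh t) + a * t + -t by ring,
      Real.exp_add _ t, Real.exp_add _ (-t)]
    generalize Real.exp (-(y * Real.sinh t) + a * t) = c
    rw [Real.sinh_eq]
    ring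
  have hi : ∀ y : ℝ, 0 < y → ∀ b : ℝ, IntegrableOn
      (fun t : ℝ => Real.exp (-(y * Real.sinh t) + b * t)) (Ioi 0) :=
    fun y hy b => integrableOn_exp_neg_mul_sinh_add hy b
  have h := hasDerivAt_integral_of_dominated_loc_of_deriv_le (𝕜 := ℝ)
    (μ := volume.restrict (Ioi (0 : ℝ))) (s := Ioi (x / 2)) (x₀ := x)
    (bound := fun t => Real.exp (-(x / 2 * Real.sinh t) + a * t) * Real.sinh t)
    (F := fun y t => Real.exp (-(y * Real.sinh t) + a * t))
    (F' := fun y t => -(Real.exp (-(y * Real.sinh t) + a * t) * Real.sinh t))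
    (Ioi_mem_nhds (by linarith))
    (Eventually.of_forall fun y => Continuous.aestronglyMeasurable (by fun_prop))
    (hi x hx a) (Continuous.aestronglyMeasurable (by fun_prop)) ?_ ?_
    (Eventually.of_forall fun t y _ => ?_)
  · refine h.2.congr_deriv ?_
    simp only [hprod]
    rw [integral_neg, integral_div, integral_sub (hi x hx _) (hi x hx _), schlafliRay, schlafliRay]
    ring
  · filter_upwards [ae_restrict_mem measurableSet_Ioi] with t ht y hy
    have hs := Real.sinh_pos_iff.2 ht
    rw [norm_neg, Real.norm_of_nonneg (by positivity)]
    have := mul_le_mul_of_nonneg_right (le_of_lt hy : x / 2 ≤ y) hs.le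
    gcongr
  · simp only [hprod]
    exact ((hi _ (half_pos hx) _).sub (hi _ (half_pos hx) _)).div_const 2
  · have h1 : HasDerivAt (fun y : ℝ => -(y * Real.sinh t) + a * t) (-Real.sinh t) y := by
      simpa using ((hasDerivAt_id y).mul_const (Real.sinh t)).fun_neg.add_const (a * t)
    exact h1.exp.congr_deriv (by ring)

theorem hasDerivAt_schlafliArc (ν x : ℝ) :
    HasDerivAt (schlafliArc ν) ((schlafliArc (ν - 1) x - schlafliArc (ν + 1) x) / 2) x := by
  have hprod : ∀ y θ : ℝ, Complex.exp (((y * Real.sin θ - ν * θ : ℝ) : ℂ) * Complex.I) *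
      (Real.sin θ * Complex.I) =
      (Complex.exp (((y * Real.sin θ - (ν - 1) * θ : ℝ) : ℂ) * Complex.I) -
        Complex.exp (((y * Real.sin θ - (ν + 1) * θ : ℝ) : ℂ) * Complex.I)) / 2 := by
    intro y θ
    have e1 : ((y * Real.sin θ - (ν - 1) * θ : ℝ) : ℂ) * Complex.I =
        ((y * Real.sin θ - ν * θ : ℝ) : ℂ) * Complex.I + θ * Complex.I := by push_cast; ring
    have e2 : ((y * Real.sin θ - (ν + 1) * θ : ℝ) : ℂ) * Complex.I =
        ((y * Real.sin θ - ν * θ : ℝ) : ℂ) * Complex.I + (-θ : ℂ) * Complex.I := by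
      push_cast; ring
    rw [e1, e2, Complex.exp_add, Complex.exp_add, Complex.exp_mul_I (θ : ℂ),
      Complex.exp_mul_I (-θ : ℂ), Complex.cos_neg, Complex.sin_neg]
    push_cast
    ring
  have hi : ∀ μ : ℝ, IntervalIntegrable (fun θ : ℝ =>
      Complex.exp (((x * Real.sin θ - μ * θ : ℝ) : ℂ) * Complex.I)) volume 0 Real.pi :=
    fun μ => Continuous.intervalIntegrable (by fun_prop) _ _
  have h := intervalIntegral.hasDerivAt_integral_of_dominated_loc_of_deriv_le (𝕜 := ℝ)
    (μ := volume) (a := 0) (b := Real.pi) (s := univ) (x₀ := x) (bound := fun _ => 1)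
    (F := fun y θ => Complex.exp (((y * Real.sin θ - ν * θ : ℝ) : ℂ) * Complex.I))
    (F' := fun y θ => Complex.exp (((y * Real.sin θ - ν * θ : ℝ) : ℂ) * Complex.I) *
      (Real.sin θ * Complex.I)) univ_mem
    (Eventually.of_forall fun y => Continuous.aestronglyMeasurable (by fun_prop))
    (hi ν) (Continuous.aestronglyMeasurable (by fun_prop))
    (Eventually.of_forall fun θ _ y _ => ?_) intervalIntegrable_const
    (Eventually.of_forall fun θ _ y _ => ?_)
  · refine h.2.congr_deriv ?_
    simp only [hprod]
    rw [intervalIntegral.integral_div, intervalIntegral.integral_sub (hi _) (hi _), schlafliArc,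
      schlafliArc]
  · rw [norm_mul, Complex.norm_exp_ofReal_mul_I, one_mul, norm_mul, Complex.norm_I, mul_one,
      Complex.norm_real]
    exact Real.abs_sin_le_one θ
  · have h1 : HasDerivAt (fun y : ℝ => y * Real.sin θ - ν * θ) (Real.sin θ) y := by
      simpa using ((hasDerivAt_id y).mul_const (Real.sin θ)).sub_const (ν * θ)
    exact (h1.ofReal_comp.mul_const Complex.I).cexp

theorem hasDerivAt_schlafliHankel (ν : ℝ) {x : ℝ} (hx : 0 < x) :
    HasDerivAt (schlafliHankel ν)
      ((schlafliHankel (ν - 1) x - schlafliHankel (ν + 1) x) / 2) x := by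
  have h1 := hasDerivAt_schlafliArc ν x
  have h2 := (hasDerivAt_schlafliRay ν hx).ofReal_comp
  have h3 := (hasDerivAt_schlafliRay (-ν) hx).ofReal_comp
  have h := (h1.sub ((h2.add (h3.const_mul
    (Complex.exp (-(Real.pi * ν * Complex.I))))).const_mul Complex.I)).div_const (Real.pi : ℂ)
  refine h.congr_deriv ?_
  have e1 : Complex.exp (-(Real.pi * ((ν - 1 : ℝ) : ℂ) * Complex.I)) =
      -Complex.exp (-(Real.pi * ν * Complex.I)) := by
    rw [show -(Real.pi * ((ν - 1 : ℝ) : ℂ) * Complex.I) =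
      -(Real.pi * ν * Complex.I) + Real.pi * Complex.I by push_cast; ring, Complex.exp_add,
      Complex.exp_pi_mul_I, mul_neg_one]
  have e2 : Complex.exp (-(Real.pi * ((ν + 1 : ℝ) : ℂ) * Complex.I)) =
      -Complex.exp (-(Real.pi * ν * Complex.I)) := by
    rw [show -(Real.pi * ((ν + 1 : ℝ) : ℂ) * Complex.I) =
      -(Real.pi * ν * Complex.I) - Real.pi * Complex.I by push_cast; ring, Complex.exp_sub,
      Complex.exp_pi_mul_I, div_neg, div_one]
  rw [schlafliHankel, schlafliHankel, e1, e2, show -(ν - 1) = -ν + 1 by ring,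
    show -(ν + 1) = -ν - 1 by ring]
  push_cast
  ring

/-! ### The Laplace integral of the Hankel function -/

/-- The entire function `∑ w^k / (k! Γ(ν + k + 1))`: with `w = ∓ x² / 4` and the factor `(x / 2)^ν`
it gives `J_ν(x)` and `I_ν(x)`. -/
noncomputable def besselSeries (ν : ℝ) (w : ℂ) : ℂ :=
  ∑' k : ℕ, w ^ k / ((k.factorial * Real.Gamma (ν + k + 1) : ℝ) : ℂ)

/-- Absolute convergence, read off from `hasSum_schlafli` with `r = √R`. -/
theorem summable_besselSeries (ν : ℝ) {R : ℝ} (hR : 0 < R) :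
    Summable fun k : ℕ => ‖R ^ k / (k.factorial * Real.Gamma (ν + k + 1))‖ := by
  have hr : 0 < Real.sqrt R := Real.sqrt_pos.2 hR
  have h := ((hasSum_schlafli hr (ε := 1) (by simp) ν).summable.mul_left
    (Real.sqrt R ^ (-ν))).norm
  refine h.congr fun k => ?_
  have : Real.sqrt R ^ (-ν) * Real.sqrt R ^ (ν + 2 * k) = R ^ k := by
    rw [← Real.rpow_add hr, show -ν + (ν + 2 * k) = ((2 * k : ℕ) : ℝ) by push_cast; ring,
      Real.rpow_natCast, pow_mul, Real.sq_sqrt hR.le]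
  rw [one_pow, mul_left_comm, this, one_div_mul_eq_div]

theorem differentiable_besselSeries (ν : ℝ) : Differentiable ℂ (besselSeries ν) := by
  intro w
  have hR : 0 < ‖w‖ + 1 := by positivity
  have h : DifferentiableOn ℂ (besselSeries ν) (Metric.ball 0 (‖w‖ + 1)) := by
    refine Complex.differentiableOn_tsum_of_summable_norm (summable_besselSeries ν hR)
      (fun k => Differentiable.differentiableOn (by fun_prop)) Metric.isOpen_ball
      fun k z hz => ?_
    rw [norm_div, norm_div, Complex.norm_real, norm_pow, norm_pow, Real.norm_of_nonneg hR.le]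
    have : ‖z‖ ≤ ‖w‖ + 1 := (mem_ball_zero_iff.1 hz).le
    gcongr
  exact (h w (by simp)).differentiableAt (Metric.isOpen_ball.mem_nhds (by simp))

theorem tsum_bessel_eq_besselSeries (ν : ℝ) {r : ℝ} (hr : 0 < r) (ε : ℝ) :
    ((∑' k : ℕ, ε ^ k / (k.factorial * Real.Gamma (ν + k + 1)) * r ^ (ν + 2 * k) : ℝ) : ℂ) =
      (r : ℂ) ^ (ν : ℂ) * besselSeries ν ((ε * r ^ 2 : ℝ) : ℂ) := by
  rw [besselSeries, Complex.ofReal_tsum, ← tsum_mul_left]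
  refine tsum_congr fun k => ?_
  have : r ^ (ν + 2 * k) = r ^ ν * (r ^ 2) ^ k := by
    rw [Real.rpow_add hr, ← pow_mul, ← Real.rpow_natCast]; push_cast; rfl
  rw [this, ← Complex.ofReal_cpow hr.le, ← Complex.ofReal_pow, ← Complex.ofReal_div,
    ← Complex.ofReal_mul]
  congr 1
  rw [mul_pow]
  ring

/-- Macdonald's formula `K_ν = (π/2) (I_(-ν) - I_ν) / sin πν`, read off from Schläfli's integral
for `I_ν`. -/
theorem besselK_eq_besselSeries {ν : ℝ} (hν : Real.sin (Real.pi * ν) ≠ 0) {x : ℝ} (hx : 0 < x) :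
    (besselK ν x : ℂ) = Real.pi / (2 * Real.sin (Real.pi * ν)) *
      ((x / 2 : ℂ) ^ (-ν : ℂ) * besselSeries (-ν) ((x / 2 : ℂ) ^ 2) -
        (x / 2 : ℂ) ^ (ν : ℂ) * besselSeries ν ((x / 2 : ℂ) ^ 2)) := by
  have hr := half_pos hx
  have hI : ∀ μ : ℝ, (x / 2 : ℂ) ^ (μ : ℂ) * besselSeries μ ((x / 2 : ℂ) ^ 2) =
      ((∑' k : ℕ, 1 ^ k / (k.factorial * Real.Gamma (μ + k + 1)) *
        (x / 2) ^ (μ + 2 * k) : ℝ) : ℂ) := by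
    intro μ
    rw [tsum_bessel_eq_besselSeries μ hr 1]
    push_cast
    rw [one_mul]
  have h1 := hI ν
  have h2 := hI (-ν)
  rw [(hasSum_schlafli hr (ε := 1) (by simp) _).tsum_eq] at h1 h2
  rw [Complex.ofReal_neg] at h2
  rw [h1, h2]
  have harc : ∀ θ : ℝ, (Complex.exp ((x / 2 : ℝ) * Complex.exp (θ * Complex.I) +
      (1 : ℝ) * (x / 2 : ℝ) * Complex.exp (-(θ * Complex.I)) -
        -(ν : ℂ) * θ * Complex.I)).re =
      (Complex.exp ((x / 2 : ℝ) * Complex.exp (θ * Complex.I) +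
      (1 : ℝ) * (x / 2 : ℝ) * Complex.exp (-(θ * Complex.I)) - ν * θ * Complex.I)).re := by
    intro θ
    have e1 : Complex.exp (θ * Complex.I) = Complex.cos θ + Complex.sin θ * Complex.I :=
      Complex.exp_mul_I _
    have e2 : Complex.exp (-(θ * Complex.I)) = Complex.cos θ - Complex.sin θ * Complex.I := by
      rw [← neg_mul, Complex.exp_mul_I, Complex.cos_neg, Complex.sin_neg]; ring
    have e3 : ∀ μ : ℝ, (Complex.exp ((x / 2 : ℝ) * Complex.exp (θ * Complex.I) +
        (1 : ℝ) * (x / 2 : ℝ) * Complex.exp (-(θ * Complex.I)) - μ * θ * Complex.I)).re =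
        Real.exp (x * Real.cos θ) * Real.cos (μ * θ) := by
      intro μ
      have : ((x / 2 : ℝ) * Complex.exp (θ * Complex.I) +
          (1 : ℝ) * (x / 2 : ℝ) * Complex.exp (-(θ * Complex.I)) - μ * θ * Complex.I : ℂ) =
          ((x * Real.cos θ : ℝ) : ℂ) + ((-(μ * θ) : ℝ) : ℂ) * Complex.I := by
        rw [e1, e2]
        push_cast
        ring
      rw [this, Complex.exp_add, ← Complex.ofReal_exp, Complex.re_ofReal_mul,
        Complex.exp_ofReal_mul_I_re, Real.cos_neg]
    have h := e3 (-ν)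
    rw [Complex.ofReal_neg] at h
    rw [h, e3, neg_mul, Real.cos_neg]
  simp only [harc]
  have hray : ∀ μ : ℝ, ∫ u in Ioi (0 : ℝ), Real.exp (-(x / 2 * Real.exp u) -
      1 * (x / 2) * Real.exp (-u) - μ * u) =
      ∫ u in Ioi (0 : ℝ), Real.exp (-(x * Real.cosh u) + -μ * u) := by
    intro μ
    refine setIntegral_congr_fun measurableSet_Ioi fun u _ => ?_
    congr 1
    rw [Real.cosh_eq]
    ring
  rw [hray, hray]
  have hK : besselK ν x = ((∫ u in Ioi (0 : ℝ), Real.exp (-(x * Real.cosh u) + -ν * u)) +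
      ∫ u in Ioi (0 : ℝ), Real.exp (-(x * Real.cosh u) + -(-ν) * u)) / 2 := by
    rw [← integral_add (integrableOn_exp_neg_mul_cosh_add hx _)
      (integrableOn_exp_neg_mul_cosh_add hx _), ← integral_div, besselK]
    refine setIntegral_congr_fun measurableSet_Ioi fun u _ => ?_
    simp only [Real.exp_add, Real.cosh_eq (ν * u), neg_mul, neg_neg]
    ring
  have hsin : Real.sin (Real.pi * -ν) = -Real.sin (Real.pi * ν) := by
    rw [mul_neg, Real.sin_neg]
  rw [hsin, ← Complex.ofReal_sub, ← Complex.ofReal_ofNat 2, ← Complex.ofReal_mul,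
    ← Complex.ofReal_div, ← Complex.ofReal_mul, hK]
  have halg : ∀ A P Q s : ℝ, s ≠ 0 →
      (P + Q) / 2 = Real.pi / (2 * s) * ((A - -s * Q) / Real.pi - (A - s * P) / Real.pi) := by
    intro A P Q s hs
    have := Real.pi_ne_zero
    field_simp
    ring
  exact congrArg _ (halg _ _ _ _ hν)

theorem besselJ_eq_besselSeries (ν : ℝ) {x : ℝ} (hx : 0 < x) :
    (besselJ ν x : ℂ) = (x / 2 : ℂ) ^ (ν : ℂ) * besselSeries ν (-(x / 2 : ℂ) ^ 2) := by
  rw [besselJ, tsum_bessel_eq_besselSeries ν (half_pos hx) (-1)]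
  push_cast
  rw [neg_one_mul]

/-- The connection between the power series and the Laplace integral in the right half-plane. By
`besselK_eq_hankelIntegral` and Macdonald's formula it holds on the positive half-line, hence by the
identity theorem in the whole half-plane. -/
theorem besselSeries_eq_hankelIntegral {ν : ℝ} (hν : Real.sin (Real.pi * ν) ≠ 0) {z : ℂ}
    (hz : 0 < z.re) :
    Real.pi / (2 * Real.sin (Real.pi * ν)) *
      ((z / 2) ^ (-ν : ℂ) * besselSeries (-ν) ((z / 2) ^ 2) -
        (z / 2) ^ (ν : ℂ) * besselSeries ν ((z / 2) ^ 2)) =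
      ((Real.sqrt (Real.pi / 2) / Real.Gamma (|ν| + 1 / 2) : ℝ) : ℂ) *
        (z ^ (-(1 / 2) : ℂ) * Complex.exp (-z) *
          hankelIntegral (|ν| - 1 / 2) (1 / (2 * z))) := by
  set U : Set ℂ := {z | 0 < z.re} with hU
  have hUo : IsOpen U := isOpen_lt continuous_const Complex.continuous_re
  have hUc : IsPreconnected U := (convex_halfSpace_re_gt 0).isPreconnected
  have hslit : ∀ w ∈ U, w ∈ Complex.slitPlane := fun w hw => Or.inl hw
  have hslit2 : ∀ w ∈ U, w / 2 ∈ Complex.slitPlane := fun w hw => by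
    left
    have hw : 0 < w.re := hw
    have : (w / 2).re = w.re / 2 := by simp
    rw [this]
    positivity
  have hd : ∀ (c : ℂ) (μ : ℝ), DifferentiableOn ℂ
      (fun w : ℂ => (w / 2) ^ c * besselSeries μ ((w / 2) ^ 2)) U := by
    intro c μ
    refine DifferentiableOn.mul ?_ ?_
    · exact DifferentiableOn.cpow_const (by fun_prop) hslit2
    · exact ((differentiable_besselSeries μ).comp (by fun_prop)).differentiableOn
  have hre : ∀ w ∈ U, 0 < (1 / (2 * w)).re := fun w hw => by
    have hw : 0 < w.re := hw
    have hw0 : w ≠ 0 := fun h => by simp [h] at hw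
    rw [one_div, Complex.inv_re]
    have : (2 * w).re = 2 * w.re := by simp
    rw [this]
    have := Complex.normSq_pos.2 (mul_ne_zero two_ne_zero hw0)
    positivity
  have hL : AnalyticOnNhd ℂ (fun w : ℂ => Real.pi / (2 * Real.sin (Real.pi * ν)) *
      ((w / 2) ^ (-ν : ℂ) * besselSeries (-ν) ((w / 2) ^ 2) -
        (w / 2) ^ (ν : ℂ) * besselSeries ν ((w / 2) ^ 2))) U :=
    (((hd _ _).sub (hd _ _)).const_mul _).analyticOnNhd hUo
  have hR : AnalyticOnNhd ℂ (fun w : ℂ =>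
      ((Real.sqrt (Real.pi / 2) / Real.Gamma (|ν| + 1 / 2) : ℝ) : ℂ) *
        (w ^ (-(1 / 2) : ℂ) * Complex.exp (-w) *
          hankelIntegral (|ν| - 1 / 2) (1 / (2 * w)))) U := by
    refine DifferentiableOn.analyticOnNhd (DifferentiableOn.const_mul
      (DifferentiableOn.mul (DifferentiableOn.mul ?_ (by fun_prop)) ?_) _) hUo
    · exact DifferentiableOn.cpow_const (by fun_prop) hslit
    · intro w hw
      have hw0 : w ≠ 0 := fun h => by simp [h, hU] at hw
      have h1 := differentiableAt_hankelIntegral (a := |ν| - 1 / 2)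
        (by linarith [abs_nonneg ν]) (hre w hw)
      have h2 : DifferentiableAt ℂ (fun w : ℂ => 1 / (2 * w)) w :=
        (differentiableAt_const _).div (by fun_prop) (mul_ne_zero two_ne_zero hw0)
      exact (DifferentiableAt.comp w h1 h2).differentiableWithinAt
  refine hL.eqOn_of_preconnected_of_frequently_eq hR hUc (z₀ := 1) (by simp [hU]) ?_ hz
  have ht : Tendsto (fun x : ℝ => (x : ℂ)) (𝓝[≠] 1) (𝓝[≠] 1) := by
    refine tendsto_nhdsWithin_iff.2 ⟨?_, ?_⟩
    · have := (Complex.continuous_ofReal.tendsto 1)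
      rw [Complex.ofReal_one] at this
      exact this.mono_left nhdsWithin_le_nhds
    · filter_upwards [self_mem_nhdsWithin] with x hx h
      exact hx (Complex.ofReal_eq_one.1 h)
  refine ht.frequently (Eventually.frequently ?_)
  filter_upwards [nhdsWithin_le_nhds (lt_mem_nhds (show (0 : ℝ) < 1 from one_pos))] with x hx
  rw [← besselK_eq_besselSeries hν hx, besselK_eq_hankelIntegral ν hx]
  have e1 : (x : ℂ) ^ (-(1 / 2) : ℂ) = ((Real.sqrt x)⁻¹ : ℝ) := by
    rw [Real.sqrt_eq_rpow, ← Real.rpow_neg hx.le, Complex.ofReal_cpow hx.le]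
    push_cast
    rfl
  have e2 : Real.sqrt (Real.pi / (2 * x)) = Real.sqrt (Real.pi / 2) * (Real.sqrt x)⁻¹ := by
    rw [← Real.sqrt_inv, ← Real.sqrt_mul (by positivity)]
    congr 1
    field_simp
  rw [e1, e2]
  push_cast
  ring

/-- The Hankel function by its Laplace integral, for noninteger `ν`: the boundary value at
`z = -i x` of the identity in the half-plane. -/
theorem schlafliHankel_eq_of_sin_ne_zero {ν : ℝ} (hν : Real.sin (Real.pi * ν) ≠ 0) {x : ℝ}
    (hx : 0 < x) :
    schlafliHankel ν x = Real.sqrt (2 / (Real.pi * x)) *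
      Complex.exp (besselPhase x ν * Complex.I) *
      (hankelIntegral (|ν| - 1 / 2) (Complex.I * (1 / (2 * x) : ℝ)) /
        Real.Gamma (|ν| + 1 / 2)) := by
  set z : ℝ → ℂ := fun δ => δ - x * Complex.I with hz
  have hz0 : z 0 = -(x * Complex.I) := by simp [hz]
  have hzre : ∀ δ, (z δ).re = δ := fun δ => by simp [hz]
  have hzc : Continuous z := by fun_prop
  have hzim : ∀ δ, (z δ).im = -x := fun δ => by simp [hz]
  have hslit : z 0 ∈ Complex.slitPlane := Or.inr (by rw [hzim]; linarith)
  have hslit2 : z 0 / 2 ∈ Complex.slitPlane := by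
    right
    have : (z 0 / 2).im = (z 0).im / 2 := by simp
    rw [this, hzim]
    intro h
    linarith
  have hne : z 0 ≠ 0 := Complex.slitPlane_ne_zero hslit
  have hev : ∀ᶠ δ in 𝓝[>] (0 : ℝ), 0 < δ := self_mem_nhdsWithin
  have hLc : ∀ (c : ℂ) (μ : ℝ), Tendsto
      (fun δ => (z δ / 2) ^ c * besselSeries μ ((z δ / 2) ^ 2)) (𝓝[>] 0)
      (𝓝 ((z 0 / 2) ^ c * besselSeries μ ((z 0 / 2) ^ 2))) := by
    intro c μ
    refine Tendsto.mono_left ?_ nhdsWithin_le_nhds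
    refine ContinuousAt.tendsto (f := fun δ => (z δ / 2) ^ c * besselSeries μ ((z δ / 2) ^ 2))
      (ContinuousAt.mul ?_ ?_)
    · exact ContinuousAt.cpow (by fun_prop) continuousAt_const hslit2
    · exact ((differentiable_besselSeries μ).continuous.comp (by fun_prop)).continuousAt
  have hinv : 1 / (2 * z 0) = Complex.I * ((1 / (2 * x) : ℝ) : ℂ) := by
    have hxc : (x : ℂ) ≠ 0 := by exact_mod_cast hx.ne'
    have hI := Complex.I_ne_zero
    rw [hz0]
    push_cast
    field_simp
    rw [Complex.I_sq]
  have hR : Tendsto (fun δ => hankelIntegral (|ν| - 1 / 2) (1 / (2 * z δ))) (𝓝[>] 0)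
      (𝓝 (hankelIntegral (|ν| - 1 / 2) (1 / (2 * z 0)))) := by
    have h0 : 0 ≤ (1 / (2 * z 0)).re := by rw [hinv]; simp
    have hcw := continuousWithinAt_hankelIntegral ν h0
    refine hcw.tendsto.comp (f := fun δ => ((ν, 1 / (2 * z δ)) : ℝ × ℂ))
      (tendsto_nhdsWithin_iff.2 ⟨?_, ?_⟩)
    · refine Tendsto.prodMk_nhds tendsto_const_nhds (Tendsto.mono_left ?_ nhdsWithin_le_nhds)
      exact ContinuousAt.tendsto (f := fun δ => 1 / (2 * z δ))
        (continuousAt_const.div (by fun_prop) (mul_ne_zero two_ne_zero hne))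
    · filter_upwards [hev] with δ hδ
      rw [one_div, Complex.inv_re]
      have : (2 * z δ).re = 2 * δ := by simp [hzre]
      rw [this]
      exact div_nonneg (by linarith) (Complex.normSq_nonneg _)
  have hpow : Tendsto (fun δ => z δ ^ (-(1 / 2) : ℂ) * Complex.exp (-z δ)) (𝓝[>] 0)
      (𝓝 (z 0 ^ (-(1 / 2) : ℂ) * Complex.exp (-z 0))) := by
    refine Tendsto.mono_left ?_ nhdsWithin_le_nhds
    refine ContinuousAt.tendsto (f := fun δ => z δ ^ (-(1 / 2) : ℂ) * Complex.exp (-z δ))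
      (ContinuousAt.mul ?_ (by fun_prop))
    exact ContinuousAt.cpow (by fun_prop) continuousAt_const hslit
  have hlim1 := ((hLc (-ν : ℂ) (-ν)).sub (hLc ν ν)).const_mul
    ((Real.pi : ℂ) / (2 * Real.sin (Real.pi * ν)))
  have hlim2 := (hpow.mul hR).const_mul
    ((Real.sqrt (Real.pi / 2) / Real.Gamma (|ν| + 1 / 2) : ℝ) : ℂ)
  have hkey := tendsto_nhds_unique (hlim1.congr' (by
    filter_upwards [hev] with δ hδ
    exact besselSeries_eq_hankelIntegral hν (by rw [hzre]; exact hδ))) hlim2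
  rw [hinv] at hkey
  -- powers of `-i x`
  have harg : ∀ c : ℝ, ∀ y : ℝ, 0 < y → (-(y * Complex.I) : ℂ) ^ (c : ℂ) =
      (y : ℂ) ^ (c : ℂ) * Complex.exp (-(Real.pi * c / 2 * Complex.I)) := by
    intro c y hy
    have hyc : (y : ℂ) ≠ 0 := by exact_mod_cast hy.ne'
    have h1 : (-(y * Complex.I) : ℂ) = (y : ℂ) * -Complex.I := by ring
    rw [h1, Complex.cpow_def_of_ne_zero (mul_ne_zero hyc (neg_ne_zero.2 Complex.I_ne_zero)),
      Complex.log_ofReal_mul hy (neg_ne_zero.2 Complex.I_ne_zero), Complex.log_neg_I,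
      Complex.cpow_def_of_ne_zero hyc, ← Complex.exp_add, Complex.ofReal_log hy.le]
    congr 1
    ring
  have hz2 : z 0 / 2 = -(((x / 2 : ℝ) : ℂ) * Complex.I) := by
    rw [hz0]; push_cast; ring
  have hz2sq : (z 0 / 2) ^ 2 = -(x / 2 : ℂ) ^ 2 := by
    rw [hz0]
    linear_combination (x / 2 : ℂ) ^ 2 * Complex.I_sq
  have hJ : ∀ μ : ℝ, (z 0 / 2) ^ (μ : ℂ) * besselSeries μ ((z 0 / 2) ^ 2) =
      besselJ μ x * Complex.exp (-(Real.pi * μ / 2 * Complex.I)) := by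
    intro μ
    rw [besselJ_eq_besselSeries μ hx, hz2sq, hz2, harg μ _ (half_pos hx)]
    push_cast
    ring
  have hsqrt : z 0 ^ (-(1 / 2) : ℂ) =
      ((Real.sqrt x)⁻¹ : ℝ) * Complex.exp (Real.pi / 4 * Complex.I) := by
    have h := harg (-(1 / 2)) x hx
    rw [← Complex.ofReal_cpow hx.le, Real.rpow_neg hx.le, ← Real.sqrt_eq_rpow] at h
    rw [hz0]
    push_cast at h ⊢
    rw [h]
    congr 2
    ring
  have hJn := hJ (-ν)
  rw [Complex.ofReal_neg] at hJn
  rw [hJn, hJ ν, hsqrt, hz0, neg_neg] at hkey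
  set a := Complex.exp (-(Real.pi * ν / 2 * Complex.I)) with ha
  set a' := Complex.exp (-(Real.pi * -ν / 2 * Complex.I)) with ha'
  set B := Complex.exp (Real.pi / 4 * Complex.I) with hB
  set M := hankelIntegral (|ν| - 1 / 2) (Complex.I * ((1 / (2 * x) : ℝ) : ℂ)) with hM
  have haa' : a * a' = 1 := by
    rw [ha, ha', ← Complex.exp_add, ← Complex.exp_zero]; congr 1; ring
  have ha2 : a * a = Real.cos (Real.pi * ν) - Real.sin (Real.pi * ν) * Complex.I := by
    rw [ha, ← Complex.exp_add]
    rw [show -(Real.pi * ν / 2 * Complex.I) + -(Real.pi * ν / 2 * Complex.I) =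
      ((-(Real.pi * ν) : ℝ) : ℂ) * Complex.I by push_cast; ring, Complex.exp_mul_I,
      ← Complex.ofReal_cos, ← Complex.ofReal_sin, Real.cos_neg, Real.sin_neg]
    push_cast
    ring
  have hphase : Complex.exp (besselPhase x ν * Complex.I) =
      Complex.exp (x * Complex.I) * a * (-Complex.I * B) := by
    have hI : -Complex.I = Complex.exp (-(Real.pi / 2) * Complex.I) := by
      rw [neg_mul, Complex.exp_neg, Complex.exp_pi_div_two_mul_I, Complex.inv_I]
    rw [ha, hB, hI, ← Complex.exp_add, ← Complex.exp_add, ← Complex.exp_add, besselPhase]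
    congr 1
    push_cast
    ring
  have hQ : Real.sqrt (2 / (Real.pi * x)) =
      2 / Real.pi * (Real.sqrt (Real.pi / 2) * (Real.sqrt x)⁻¹) := by
    rw [← Real.sqrt_inv, ← Real.sqrt_mul (by positivity),
      ← Real.sqrt_sq (show 0 ≤ 2 / Real.pi by positivity), ← Real.sqrt_mul (by positivity)]
    congr 1
    field_simp
  have hH : schlafliHankel ν x = besselJ ν x + ((besselJ ν x * Real.cos (Real.pi * ν) -
      besselJ (-ν) x) / Real.sin (Real.pi * ν) : ℝ) * Complex.I := by
    rw [← im_schlafliHankel_of_sin_ne_zero hν hx, ← re_schlafliHankel ν hx, Complex.re_add_im]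
  have hG : (Real.Gamma (|ν| + 1 / 2) : ℂ) ≠ 0 := by
    exact_mod_cast (Real.Gamma_pos_of_pos (by positivity)).ne'
  have hs : (Real.sin (Real.pi * ν) : ℂ) ≠ 0 := by exact_mod_cast hν
  have hπ : (Real.pi : ℂ) ≠ 0 := by exact_mod_cast Real.pi_ne_zero
  have hrhs : (Real.sqrt (2 / (Real.pi * x)) : ℂ) *
      Complex.exp (besselPhase x ν * Complex.I) * (M / Real.Gamma (|ν| + 1 / 2)) =
      -Complex.I * a * (2 / Real.pi) * (((Real.sqrt (Real.pi / 2) / Real.Gamma (|ν| + 1 / 2) : ℝ) :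
        ℂ) * ((((Real.sqrt x)⁻¹ : ℝ) * B) * Complex.exp (x * Complex.I) * M)) := by
    rw [hphase, hQ]
    push_cast
    ring
  rw [hrhs, ← hkey, hH]
  push_cast at ha2 hs ⊢
  field_simp
  linear_combination (-Complex.I * besselJ ν x) * ha2 + Complex.I * besselJ (-ν) x * haa' +
    besselJ ν x * Complex.sin (Real.pi * ν) * Complex.I_sq

/-- The Hankel function by its Laplace integral. Both sides are continuous in `ν`, so that the
integers need no separate argument. -/
theorem schlafliHankel_eq (ν : ℝ) {x : ℝ} (hx : 0 < x) :
    schlafliHankel ν x = Real.sqrt (2 / (Real.pi * x)) *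
      Complex.exp (besselPhase x ν * Complex.I) *
      (hankelIntegral (|ν| - 1 / 2) (Complex.I * (1 / (2 * x) : ℝ)) /
        Real.Gamma (|ν| + 1 / 2)) := by
  have h1 : Tendsto (fun μ => schlafliHankel μ x) (𝓝[≠] ν) (𝓝 (schlafliHankel ν x)) :=
    ((continuous_schlafliHankel hx).tendsto ν).mono_left nhdsWithin_le_nhds
  have hre : 0 ≤ (Complex.I * ((1 / (2 * x) : ℝ) : ℂ)).re := by simp
  have h2 : Tendsto (fun μ : ℝ => hankelIntegral (|μ| - 1 / 2) (Complex.I * (1 / (2 * x) : ℝ)))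
      (𝓝[≠] ν) (𝓝 (hankelIntegral (|ν| - 1 / 2) (Complex.I * (1 / (2 * x) : ℝ)))) := by
    refine (continuousWithinAt_hankelIntegral ν hre).tendsto.comp
      (f := fun μ : ℝ => ((μ, Complex.I * ((1 / (2 * x) : ℝ) : ℂ)) : ℝ × ℂ))
      (tendsto_nhdsWithin_iff.2 ⟨?_, Eventually.of_forall fun μ => hre⟩)
    exact ((show Continuous fun μ : ℝ => ((μ, Complex.I * ((1 / (2 * x) : ℝ) : ℂ)) : ℝ × ℂ) by
      fun_prop).tendsto ν).mono_left nhdsWithin_le_nhds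
  have hGpos : 0 < |ν| + 1 / 2 := by positivity
  have hGc : ContinuousAt (fun μ : ℝ => (Real.Gamma (|μ| + 1 / 2) : ℂ)) ν := by
    refine Complex.continuous_ofReal.continuousAt.comp ?_
    have hd := (Real.differentiableAt_Gamma (s := |ν| + 1 / 2)
      (fun m h => by linarith [(Nat.cast_nonneg m : (0 : ℝ) ≤ m)])).continuousAt
    exact ContinuousAt.comp (f := fun μ : ℝ => |μ| + 1 / 2) hd (by fun_prop)
  have hG0 : (Real.Gamma (|ν| + 1 / 2) : ℂ) ≠ 0 := by
    exact_mod_cast (Real.Gamma_pos_of_pos hGpos).ne'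
  have h3 : Tendsto (fun μ : ℝ => (Real.sqrt (2 / (Real.pi * x)) : ℂ) *
      Complex.exp (besselPhase x μ * Complex.I)) (𝓝[≠] ν)
      (𝓝 (Real.sqrt (2 / (Real.pi * x)) * Complex.exp (besselPhase x ν * Complex.I))) := by
    unfold besselPhase
    exact ((show Continuous fun μ : ℝ => (Real.sqrt (2 / (Real.pi * x)) : ℂ) *
      Complex.exp (((x - Real.pi / 2 * μ - Real.pi / 4 : ℝ) : ℂ) * Complex.I) by
      fun_prop).tendsto ν).mono_left nhdsWithin_le_nhds
  refine tendsto_nhds_unique (h1.congr' ?_)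
    (h3.mul (h2.div (hGc.tendsto.mono_left nhdsWithin_le_nhds) hG0))
  filter_upwards [eventually_sin_pi_mul_ne_zero ν] with μ hμ
  exact schlafliHankel_eq_of_sin_ne_zero hμ hx

/-! ### The coefficients, and the expansions of the derivatives -/

/-- The coefficients `a_n(ν) = ∏ (4 ν² - (2 k - 1)²) / (8ⁿ n!)`, `1 ≤ k ≤ n`, of the expansions of
the Bessel functions themselves. -/
noncomputable def coeffA (ν : ℝ) (n : ℕ) : ℝ :=
  (∏ k ∈ Finset.range n, (ν ^ 2 - (k + 1 / 2) ^ 2)) / (2 ^ n * n.factorial)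

theorem Gamma_add_nat {s : ℝ} (hs : 0 < s) (n : ℕ) :
    Real.Gamma (s + n) = Real.Gamma s * ∏ k ∈ Finset.range n, (s + k) := by
  induction n with
  | zero => simp
  | succ n ih =>
    rw [Finset.prod_range_succ, Nat.cast_succ, ← add_assoc, Real.Gamma_add_one (by positivity), ih]
    ring

/-- The terms of `hankelIntegral_expansion` for `a = |ν| - 1/2` and `h = 1 / (2 x)`, normalized. -/
theorem coeffA_eq (ν : ℝ) (n : ℕ) {x : ℝ} (hx : 0 < x) :
    genBinom (|ν| - 1 / 2) n * Real.Gamma (|ν| - 1 / 2 + n + 1) * (1 / (2 * x)) ^ n /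
      Real.Gamma (|ν| + 1 / 2) = coeffA ν n / x ^ n := by
  have hpos : 0 < |ν| + 1 / 2 := by positivity
  have hG := (Real.Gamma_pos_of_pos hpos).ne'
  rw [show |ν| - 1 / 2 + (n : ℝ) + 1 = |ν| + 1 / 2 + n by ring, Gamma_add_nat hpos, genBinom,
    coeffA]
  have : ∀ k ∈ Finset.range n, ν ^ 2 - ((k : ℝ) + 1 / 2) ^ 2 =
      (|ν| - 1 / 2 - k) * (|ν| + 1 / 2 + k) := by
    intro k _
    rw [← sq_abs ν]
    ring
  rw [Finset.prod_congr rfl this, Finset.prod_mul_distrib, div_pow, mul_pow, one_pow]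
  generalize ∏ k ∈ Finset.range n, (|ν| - 1 / 2 - (k : ℝ)) = p
  generalize ∏ k ∈ Finset.range n, (|ν| + 1 / 2 + (k : ℝ)) = q
  have hf : ((n.factorial : ℕ) : ℝ) ≠ 0 := by positivity
  field_simp

/-- The Laplace integral normalized so as to have an expansion with leading coefficient `1`; it is
the slowly varying factor of `K_ν(x)` for `ε = 1` and of `J_ν(x) + i Y_ν(x)` for `ε = i`. -/
noncomputable def hankelFactor (ε : ℂ) (ν x : ℝ) : ℂ :=
  hankelIntegral (|ν| - 1 / 2) (ε * (1 / (2 * x) : ℝ)) / Real.Gamma (|ν| + 1 / 2)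

/-- The expansion of the Bessel functions themselves. The condition on `ν` says that
`N > |ν| - 1/2`. For `ε = i` and `N = 1` positivity of the real part needs `N - a ≤ 2`, which holds
since `a ≥ -1/2`. -/
theorem hankelFactor_expansion {ε : ℂ} (hε : ε = 1 ∨ ε = Complex.I) {N : ℕ} (hN : 1 ≤ N) {ν : ℝ}
    (hν : |ν| < N + 1 / 2) {x : ℝ} (hx : 0 < x) :
    ∃ Θ : ℂ, 0 < Θ.re ∧ Θ.re < 1 ∧ hankelFactor ε ν x =
      ∑ n ∈ Finset.range N, ((coeffA ν n / x ^ n : ℝ) : ℂ) * ε ^ n +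
        ((coeffA ν N / x ^ N : ℝ) : ℂ) * ε ^ N * Θ := by
  have hν0 := abs_nonneg ν
  have hre : 0 ≤ ε.re := by rcases hε with rfl | rfl <;> simp
  have hnorm : ‖ε‖ = 1 := by rcases hε with rfl | rfl <;> simp
  have hpos : ∀ y : ℝ, 0 < y →
      0 < (taylorKernel ε ((N : ℝ) - (|ν| - 1 / 2)) N y).re := by
    intro y hy
    rcases hε with rfl | rfl
    · exact re_taylorKernel_one_pos _ _ hy
    · refine re_taylorKernel_I_pos (by linarith) hN ?_ hy
      rcases hN.eq_or_lt with h | h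
      · left
        rw [← h]
        push_cast
        linarith
      · exact Or.inr h
  obtain ⟨Θ, h0, h1, h⟩ := hankelIntegral_expansion hre hnorm (a := |ν| - 1 / 2) (by linarith)
    (by linarith) hpos (h := 1 / (2 * x)) (by positivity)
  refine ⟨Θ, h0, h1, ?_⟩
  rw [hankelFactor, h, add_div, Finset.sum_div]
  congr 1
  · refine Finset.sum_congr rfl fun n _ => ?_
    rw [← coeffA_eq ν n hx, Complex.ofReal_div _ (Real.Gamma _)]
    ring
  · rw [← coeffA_eq ν N hx, Complex.ofReal_div _ (Real.Gamma _)]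
    ring

/-- With `ν² - (k + 1/2)² = (ν - k - 1/2) (ν + k + 1/2)`, the shift of `ν` by `1` shifts the factors
of either kind among themselves. -/
theorem prod_sq_add_one (ν : ℝ) (n : ℕ) :
    ∏ k ∈ Finset.range (n + 1), ((ν + 1) ^ 2 - ((k : ℝ) + 1 / 2) ^ 2) =
      (∏ k ∈ Finset.range n, (ν ^ 2 - ((k : ℝ) + 1 / 2) ^ 2)) *
        ((ν + n + 1 / 2) * (ν + n + 3 / 2)) := by
  induction n with
  | zero => simp; ring
  | succ n ih =>
    rw [Finset.prod_range_succ, ih, Finset.prod_range_succ _ n]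
    push_cast
    ring

theorem coeffA_add_one (ν : ℝ) (n : ℕ) : coeffA (ν + 1) (n + 1) =
    (∏ k ∈ Finset.range n, (ν ^ 2 - ((k : ℝ) + 1 / 2) ^ 2)) *
      ((ν + n + 1 / 2) * (ν + n + 3 / 2)) / (2 ^ (n + 1) * (n + 1).factorial) := by
  rw [coeffA, prod_sq_add_one]

theorem coeffA_sub_one (ν : ℝ) (n : ℕ) : coeffA (ν - 1) (n + 1) =
    (∏ k ∈ Finset.range n, (ν ^ 2 - ((k : ℝ) + 1 / 2) ^ 2)) *
      ((ν - n - 1 / 2) * (ν - n - 3 / 2)) / (2 ^ (n + 1) * (n + 1).factorial) := by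
  have h : coeffA (ν - 1) (n + 1) = coeffA (-ν + 1) (n + 1) := by
    simp only [coeffA, show (ν - 1) ^ 2 = (-ν + 1) ^ 2 by ring]
  rw [h, coeffA_add_one]
  simp only [neg_sq]
  ring

/-- The coefficients of the expansions of the derivatives are the means of those of orders `ν - 1`
and `ν + 1`. -/
theorem coeffB_eq (ν : ℝ) (n : ℕ) : coeffB ν n = (coeffA (ν - 1) n + coeffA (ν + 1) n) / 2 := by
  cases n with
  | zero => simp [coeffB, coeffA]
  | succ n =>
    have h : ∀ k ∈ Finset.range n, 4 * ν ^ 2 - (2 * (k : ℝ) + 1) ^ 2 =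
        4 * (ν ^ 2 - ((k : ℝ) + 1 / 2) ^ 2) := by
      intro k _
      ring
    rw [coeffA_sub_one, coeffA_add_one, coeffB, Finset.prod_congr rfl h, Finset.prod_mul_distrib,
      Finset.prod_const, Finset.card_range]
    have h8 : (8 : ℝ) ^ (n + 1) = 4 ^ (n + 1) * 2 ^ (n + 1) := by
      rw [← mul_pow]; norm_num
    have hf : (((n + 1).factorial : ℕ) : ℝ) ≠ 0 := by positivity
    rw [h8]
    generalize ∏ k ∈ Finset.range n, (ν ^ 2 - ((k : ℝ) + 1 / 2) ^ 2) = p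
    field_simp
    ring

/-- For `n = N - 1`, the coefficients `a_N(ν ± 1)` are a common factor times
`(ν ± (n + 1/2)) (ν ± (n + 3/2))`, and this is positive for `|ν| < N - 1/2 = n + 1/2`. The common
factor may vanish. -/
theorem coeffA_mul_nonneg {N : ℕ} (hN : 1 ≤ N) {ν : ℝ} (hν : |ν| < (N : ℝ) - 1 / 2) :
    0 ≤ coeffA (ν - 1) N * coeffA (ν + 1) N := by
  obtain ⟨n, rfl⟩ := Nat.exists_eq_add_of_le' hN
  rw [coeffA_sub_one, coeffA_add_one, div_mul_div_comm]
  refine div_nonneg ?_ (by positivity)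
  push_cast at hν
  obtain ⟨h1, h2⟩ := abs_lt.1 hν
  have h3 : 0 ≤ (n + 1 / 2 - ν) * (n + 3 / 2 - ν) * ((ν + n + 1 / 2) * (ν + n + 3 / 2)) :=
    mul_nonneg (mul_nonneg (by linarith) (by linarith)) (mul_nonneg (by linarith) (by linarith))
  refine (mul_nonneg (sq_nonneg (∏ k ∈ Finset.range n, (ν ^ 2 - ((k : ℝ) + 1 / 2) ^ 2))) h3
    ).trans_eq ?_
  ring

theorem exists_mean_of_mul_nonneg {p q α β : ℝ} (hpq : 0 ≤ p * q) (hα : 0 < α) (hα1 : α < 1)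
    (hβ : 0 < β) (hβ1 : β < 1) : ∃ θ, 0 < θ ∧ θ < 1 ∧ p * α + q * β = (p + q) * θ := by
  by_cases h : p + q = 0
  · have hp : p = 0 := by nlinarith [sq_nonneg p]
    have hq : q = 0 := by linarith
    exact ⟨1 / 2, by norm_num, by norm_num, by simp [hp, hq]⟩
  · have hw : p / (p + q) + q / (p + q) = 1 := by rw [← add_div, div_self h]
    have hs : 0 < (p + q) ^ 2 := by positivity
    have hp : 0 ≤ p / (p + q) := by
      have : p / (p + q) = (p * p + p * q) / (p + q) ^ 2 := by field_simp
      rw [this]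
      exact div_nonneg (by nlinarith) hs.le
    have hq : 0 ≤ q / (p + q) := by
      have : q / (p + q) = (q * q + p * q) / (p + q) ^ 2 := by field_simp; ring
      rw [this]
      exact div_nonneg (by nlinarith) hs.le
    refine ⟨p / (p + q) * α + q / (p + q) * β, ?_, ?_, ?_⟩
    · rcases hp.eq_or_lt with h0 | h0
      · have : q / (p + q) = 1 := by linarith
        rw [← h0, this]; linarith
      · have := mul_pos h0 hα
        have := mul_nonneg hq hβ.le
        linarith
    · rcases hp.eq_or_lt with h0 | h0
      · have : q / (p + q) = 1 := by linarith
        rw [← h0, this]; linarith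
      · have := mul_lt_mul_of_pos_left hα1 h0
        have := mul_le_mul_of_nonneg_left hβ1.le hq
        linarith
    · field_simp

/-- The expansion of the mean of the factors of orders `ν - 1` and `ν + 1`, which is the one that
belongs to the derivatives. Since `a_N(ν - 1)` and `a_N(ν + 1)` do not have opposite signs, the
two remainders combine to a mean. -/
theorem hankelFactor_mean_expansion {ε : ℂ} (hε : ε = 1 ∨ ε = Complex.I) {N : ℕ} (hN : 1 ≤ N)
    {ν : ℝ} (hν : |ν| < (N : ℝ) - 1 / 2) {x : ℝ} (hx : 0 < x) :
    ∃ (W : ℂ) (θ : ℝ), 0 < θ ∧ θ < 1 ∧ W.re = coeffB ν N / x ^ N * θ ∧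
      (hankelFactor ε (ν - 1) x + hankelFactor ε (ν + 1) x) / 2 =
        ∑ n ∈ Finset.range N, ((coeffB ν n / x ^ n : ℝ) : ℂ) * ε ^ n + ε ^ N * W := by
  obtain ⟨hν1, hν2⟩ := abs_lt.1 hν
  obtain ⟨Θ, h0, h1, h⟩ := hankelFactor_expansion hε hN (ν := ν - 1)
    (abs_lt.2 ⟨by linarith, by linarith⟩) hx
  obtain ⟨Θ', h0', h1', h'⟩ := hankelFactor_expansion hε hN (ν := ν + 1)
    (abs_lt.2 ⟨by linarith, by linarith⟩) hx
  obtain ⟨θ, hθ0, hθ1, hθ⟩ := exists_mean_of_mul_nonneg (coeffA_mul_nonneg hN hν) h0 h1 h0' h1'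
  refine ⟨(((coeffA (ν - 1) N / x ^ N : ℝ) : ℂ) * Θ + ((coeffA (ν + 1) N / x ^ N : ℝ) : ℂ) * Θ') /
    2, θ, hθ0, hθ1, ?_, ?_⟩
  · rw [← Complex.ofReal_ofNat 2, Complex.div_ofReal_re, Complex.add_re, Complex.re_ofReal_mul,
      Complex.re_ofReal_mul, coeffB_eq]
    linear_combination (1 / (2 * x ^ N)) * hθ
  · have hsum : ∑ n ∈ Finset.range N, ((coeffB ν n / x ^ n : ℝ) : ℂ) * ε ^ n =
        (∑ n ∈ Finset.range N, ((coeffA (ν - 1) n / x ^ n : ℝ) : ℂ) * ε ^ n +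
          ∑ n ∈ Finset.range N, ((coeffA (ν + 1) n / x ^ n : ℝ) : ℂ) * ε ^ n) / 2 := by
      rw [← Finset.sum_add_distrib, Finset.sum_div]
      refine Finset.sum_congr rfl fun n _ => ?_
      rw [coeffB_eq]
      push_cast
      ring
    rw [h, h', hsum]
    ring

/-- The slowly varying factor of `K_ν'`, from `K' = -(K_(ν - 1) + K_(ν + 1)) / 2`. -/
theorem neg_besselKDeriv_div (ν : ℝ) {x : ℝ} (hx : 0 < x) :
    -besselKDeriv ν x / (Real.sqrt (Real.pi / (2 * x)) * Real.exp (-x)) =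
      ((hankelFactor 1 (ν - 1) x + hankelFactor 1 (ν + 1) x) / 2).re := by
  have hK : ∀ μ : ℝ, besselK μ x =
      Real.sqrt (Real.pi / (2 * x)) * Real.exp (-x) * (hankelFactor 1 μ x).re := by
    intro μ
    rw [← Complex.re_ofReal_mul, ← Complex.ofReal_re (besselK μ x), besselK_eq_hankelIntegral μ hx,
      hankelFactor, one_mul]
    congr 1
    push_cast
    ring
  have hd : besselKDeriv ν x = -(besselK (ν - 1) x + besselK (ν + 1) x) / 2 :=
    (hasDerivAt_besselK ν hx).deriv
  have hc : Real.sqrt (Real.pi / (2 * x)) * Real.exp (-x) ≠ 0 := by positivity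
  rw [hd, hK, hK, ← Complex.ofReal_ofNat 2, Complex.div_ofReal_re, Complex.add_re,
    div_eq_iff hc]
  ring

theorem schlafliHankel_eq_hankelFactor (ν : ℝ) {x : ℝ} (hx : 0 < x) :
    schlafliHankel ν x = Real.sqrt (2 / (Real.pi * x)) *
      Complex.exp (besselPhase x ν * Complex.I) * hankelFactor Complex.I ν x :=
  schlafliHankel_eq ν hx

/-- The derivative of the Hankel function, from `H' = (H_(ν - 1) - H_(ν + 1)) / 2`; the phases of
orders `ν ∓ 1` differ from that of order `ν` by `± π / 2`. -/
theorem besselDeriv_eq_hankelFactor (ν : ℝ) {x : ℝ} (hx : 0 < x) :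
    (besselJDeriv ν x : ℂ) + besselYDeriv ν x * Complex.I =
      Real.sqrt (2 / (Real.pi * x)) * Complex.exp (besselPhase x ν * Complex.I) * Complex.I *
        ((hankelFactor Complex.I (ν - 1) x + hankelFactor Complex.I (ν + 1) x) / 2) := by
  have hd := hasDerivAt_schlafliHankel ν hx
  have hJ : besselJDeriv ν x =
      ((schlafliHankel (ν - 1) x - schlafliHankel (ν + 1) x) / 2).re := by
    have h := Complex.reCLM.hasFDerivAt.comp_hasDerivAt x hd
    refine (h.congr_of_eventuallyEq ?_).deriv
    filter_upwards [lt_mem_nhds hx] with y hy using (re_schlafliHankel ν hy).symm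
  have hY : besselYDeriv ν x =
      ((schlafliHankel (ν - 1) x - schlafliHankel (ν + 1) x) / 2).im := by
    have h := Complex.imCLM.hasFDerivAt.comp_hasDerivAt x hd
    refine (h.congr_of_eventuallyEq ?_).deriv
    filter_upwards [lt_mem_nhds hx] with y hy using (im_schlafliHankel ν hy).symm
  have e1 : Complex.exp (besselPhase x (ν - 1) * Complex.I) =
      Complex.exp (besselPhase x ν * Complex.I) * Complex.I := by
    rw [show (besselPhase x (ν - 1) : ℂ) * Complex.I =
      besselPhase x ν * Complex.I + Real.pi / 2 * Complex.I by
        unfold besselPhase; push_cast; ring, Complex.exp_add, Complex.exp_pi_div_two_mul_I]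
  have e2 : Complex.exp (besselPhase x (ν + 1) * Complex.I) =
      -(Complex.exp (besselPhase x ν * Complex.I) * Complex.I) := by
    rw [show (besselPhase x (ν + 1) : ℂ) * Complex.I =
      besselPhase x ν * Complex.I - Real.pi / 2 * Complex.I by
        unfold besselPhase; push_cast; ring, Complex.exp_sub, Complex.exp_pi_div_two_mul_I,
      Complex.div_I]
  rw [hJ, hY, Complex.re_add_im, schlafliHankel_eq_hankelFactor _ hx,
    schlafliHankel_eq_hankelFactor _ hx, e1, e2]
  ring

/-- The combinations of `J_ν'` and `Y_ν'` in which the phase has been rotated away; they are the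
ones that define the remainders. -/
theorem besselDeriv_rotated (ν : ℝ) {x : ℝ} (hx : 0 < x) :
    (-Real.sin (besselPhase x ν) * besselJDeriv ν x +
      Real.cos (besselPhase x ν) * besselYDeriv ν x) / Real.sqrt (2 / (Real.pi * x)) =
        ((hankelFactor Complex.I (ν - 1) x + hankelFactor Complex.I (ν + 1) x) / 2).re ∧
    (Real.cos (besselPhase x ν) * besselJDeriv ν x +
      Real.sin (besselPhase x ν) * besselYDeriv ν x) / Real.sqrt (2 / (Real.pi * x)) =
        -((hankelFactor Complex.I (ν - 1) x + hankelFactor Complex.I (ν + 1) x) / 2).im := by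
  have h := besselDeriv_eq_hankelFactor ν hx
  generalize (hankelFactor Complex.I (ν - 1) x + hankelFactor Complex.I (ν + 1) x) / 2 = B at h ⊢
  have hc : Real.sqrt (2 / (Real.pi * x)) ≠ 0 := by positivity
  generalize Real.sqrt (2 / (Real.pi * x)) = c at h hc ⊢
  rw [Complex.exp_mul_I, ← Complex.ofReal_cos, ← Complex.ofReal_sin] at h
  have hsc := Real.sin_sq_add_cos_sq (besselPhase x ν)
  generalize Real.sin (besselPhase x ν) = s at h hsc ⊢
  generalize Real.cos (besselPhase x ν) = d at h hsc ⊢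
  have hre := congrArg Complex.re h
  have him := congrArg Complex.im h
  simp only [Complex.add_re, Complex.add_im, Complex.mul_re, Complex.mul_im, Complex.ofReal_re,
    Complex.ofReal_im, Complex.I_re, Complex.I_im] at hre him
  ring_nf at hre him
  constructor
  · rw [div_eq_iff hc]
    linear_combination (-s) * hre + d * him + c * B.re * hsc
  · rw [div_eq_iff hc]
    linear_combination d * hre + s * him - c * B.im * hsc

/-- The terms of even and of odd index form the real and the imaginary part. -/
theorem sum_mul_I_pow (c : ℕ → ℝ) (m : ℕ) :
    ∑ n ∈ Finset.range (2 * m), (c n : ℂ) * Complex.I ^ n =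
      ((∑ k ∈ Finset.range m, (-1) ^ k * c (2 * k) : ℝ) : ℂ) +
        ((∑ k ∈ Finset.range m, (-1) ^ k * c (2 * k + 1) : ℝ) : ℂ) * Complex.I := by
  induction m with
  | zero => simp
  | succ m ih =>
    rw [show 2 * (m + 1) = 2 * m + 1 + 1 by ring, Finset.sum_range_succ, Finset.sum_range_succ, ih,
      Finset.sum_range_succ, Finset.sum_range_succ, pow_succ, pow_mul, Complex.I_sq]
    push_cast
    ring

theorem theorem5 (N : ℕ) (hN : 1 ≤ N) (z : ℝ) (hz : 0 < z) (ν : ℝ) (hν : |ν| < (N : ℝ) - 1 / 2) :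
    (∃ θ : ℝ, 0 < θ ∧ θ < 1 ∧ remKDeriv N z ν = coeffB ν N / z ^ N * θ) ∧
    (∃ θ : ℝ, 0 < θ ∧ θ < 1 ∧
      remJDeriv N z ν = (-1) ^ ⌈(N : ℝ) / 2⌉₊ * (coeffB ν N / z ^ N) * θ) := by
  constructor
  · obtain ⟨W, θ, h0, h1, hW, h⟩ := hankelFactor_mean_expansion (Or.inl rfl) hN hν hz
    refine ⟨θ, h0, h1, ?_⟩
    rw [remKDeriv, neg_besselKDeriv_div ν hz, h, ← hW]
    simp only [one_pow, mul_one, one_mul, Complex.add_re, Complex.re_sum, Complex.ofReal_re]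
    ring
  · obtain ⟨W, θ, h0, h1, hW, h⟩ := hankelFactor_mean_expansion (Or.inr rfl) hN hν hz
    refine ⟨θ, h0, h1, ?_⟩
    obtain ⟨hR, hI⟩ := besselDeriv_rotated ν hz
    -- `W` is complex: for even `N` the factor `i^N` is `± 1` and the real part is taken, for
    -- odd `N` it is `± i` and the imaginary part is taken; in both cases only `Re W` enters.
    rcases Nat.even_or_odd' N with ⟨m, rfl | rfl⟩
    · have hceil : ⌈((2 * m : ℕ) : ℝ) / 2⌉₊ = m := by
        rw [Nat.cast_mul, Nat.cast_ofNat, mul_div_cancel_left₀ _ two_ne_zero, Nat.ceil_natCast]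
      have hpow : (Complex.I ^ (2 * m)) = (((-1) ^ m : ℝ) : ℂ) := by
        rw [pow_mul, Complex.I_sq]; push_cast; rfl
      rw [remJDeriv_even, hR, h, sum_mul_I_pow, hceil, hpow, mul_assoc, ← hW, evenSum]
      simp only [Complex.add_re, Complex.mul_re, Complex.ofReal_re, Complex.ofReal_im,
        Complex.I_re, Complex.I_im]
      ring
    · have hceil : ⌈((2 * m + 1 : ℕ) : ℝ) / 2⌉₊ = m + 1 := by
        rw [Nat.ceil_eq_iff (by omega)]
        rw [Nat.add_sub_cancel]
        push_cast
        constructor <;> linarith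
      have hpow : (Complex.I ^ (2 * m)) = (((-1) ^ m : ℝ) : ℂ) := by
        rw [pow_mul, Complex.I_sq]; push_cast; rfl
      rw [remJDeriv_odd, hI, h, Finset.sum_range_succ, sum_mul_I_pow, hceil, pow_succ Complex.I,
        hpow, mul_assoc ((-1 : ℝ) ^ (m + 1)), ← hW, oddSum]
      simp only [Complex.add_im, Complex.mul_im, Complex.ofReal_im, Complex.ofReal_re,
        Complex.I_im, Complex.I_re, Complex.mul_re]
      ring
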